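/- **Notation.** $\Lambda$ is the ring of symmetric functions over $\mathbb C$, with power sums $p_\nu$ and Schur functions $s_\lambda$. For a partition $\mu$, $|\mu|$ is the sum of its parts, $\ell(\mu)$ the number of its parts, $m_i(\mu)$ the number of parts equal to $i$, and $m(\mu)! := \prod_{i\ge 1} m_i(\mu)!$. For $n\ge|\mu|$ put $\mu(n) := (\mu_1,\dots,\mu_r,1^{\,n-|\mu|})\vdash n$. For sequences $I=(i_1,\dots,i_k)$ and $J=(j_1,\dots,j_k)$ of distinct elements of $[n]$, the atomic symmetric function is $A_{n,I,J} := n!\cdot \mathrm{ch}_n(R\,\mathbf 1_{I,J})$, where $\mathbf 1_{I,J}(w)=1$ if $w(i_a)=j_a$ for all $a$ and $0$ otherwise, $(Rf)(w)=\frac1{n!}\sum_{v\in\mathfrak S_n} f(v^{-1}wv)$ and $\mathrm{ch}_n(f)=\frac1{n!}\sum_{w\in\mathfrak S_n} f(w)\,p_{\mathrm{cyc}(w)}$, with $\mathrm{cyc}(w)$ the cycle type of $w$. For $\nu\vdash n$, the path power sum $\vec p_\nu$ is $A_{n,I,J}$ for any $(I,J)$ such that the directed graph on $[n]$ with edges $i_a\to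 j_a$ is a disjoint union of directed paths with $\nu_1,\nu_2,\dots$ vertices. A ribbon is a nonempty edgewise connected skew diagram (English convention) containing no $2\times2$ square. Its height is the number of rows it occupies minus one, its sign is $(-1)^{\text{height}}$, and its tail is its southwesternmost box. A monotonic ribbon tiling $T$ of a partition $\lambda=\mathrm{shape}(T)$ is a disjoint union decomposition $\lambda=\xi^{(1)}\sqcup\dots\sqcup\xi^{(r)}$ into ribbons whose tails lie in columns $c_1<\dots<c_r$ and such that $\xi^{(1)}\sqcup\dots\sqcup\xi^{(i)}$ is the Young diagram of a partition for all $0\le i\le r$. Let $\mathrm{sign}(T)$ be the product of the signs of its ribbons, $\rho_i(T)$ the number of its ribbons of size $i$, and $\rho(T)$ the number of all its ribbons. $T$ is frozen if none of its ribbons has its tail in the first row (the empty tiling is frozen). If $|\mathrm{shape}(T)|\le n$, let $\sigma(T,n)\vdash n$ be the partition obtained from $\mathrm{shape}(T)$ by adding $n-|\mathrm{shape}(T)|$ boxes to its first row. **Proposition.** Let $\mu$ be a partition all of whose parts are $>1$. For $n\ge|\mu|$ let $\mathcal F_n$ be the set of frozen monotonic ribbon tilings $T_0$ with $\rho_1(T_0)\le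 n-|\mu|$ and $\rho_i(T_0)\le m_i(\mu)$ for all $i>1$. 1. For every $n\ge|\mu|$ the set $\mathcal F_n$ is finite and $$\vec p_{\mu(n)} = (n-|\mu|)!\; m(\mu)! \sum_{T_0\in\mathcal F_n} \mathrm{sign}(T_0)\binom{n-|\mu|+\ell(\mu)-\rho(T_0)}{n-|\mu|-\rho_1(T_0),\; m_2(\mu)-\rho_2(T_0),\; m_3(\mu)-\rho_3(T_0),\dots}\, s_{\sigma(T_0,n)}.$$ 2. The set $\mathcal F_n$ is one and the same finite set for all $n\ge 2(|\mu|-\ell(\mu))$. 3. For every $n\ge|\mu|$ and every $T_0\in\mathcal F_n$, $$\sigma(T_0,n)_1-\sigma(T_0,n)_2\;\ge\; n-2(|\mu|-\ell(\mu)).$$ -/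

import Mathlib

noncomputable section

namespace PathPower

open MvPolynomial

/-! ### The ring of symmetric functions as a limit of rings of symmetric polynomials -/

/-- Setting the last variable to zero:
`f(x_1, …, x_N, x_{N+1}) ↦ f(x_1, …, x_N, 0)`. -/
def dropLast (N : ℕ) : MvPolynomial (Fin (N + 1)) ℂ →ₐ[ℂ] MvPolynomial (Fin N) ℂ :=
  aeval (Fin.snoc (α := fun _ => MvPolynomial (Fin N) ℂ) X 0)

/-- The ring `Λ` of symmetric functions over `ℂ` in infinitely many variables: an element is the
family of its specializations `f(x_1, …, x_N)`, i.e. a family of symmetric polynomials of bounded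
degree that is compatible with setting the last variable to zero. -/
def SymFun : Subalgebra ℂ (∀ N : ℕ, MvPolynomial (Fin N) ℂ) where
  carrier := {f | (∀ N, (f N).IsSymmetric) ∧ (∀ N, dropLast N (f (N + 1)) = f N) ∧
    ∃ d, ∀ N, (f N).totalDegree ≤ d}
  mul_mem' := by
    rintro f g ⟨hf, hf', d, hd⟩ ⟨hg, hg', e, he⟩
    refine ⟨fun N => (hf N).mul (hg N), fun N => ?_, d + e, fun N => ?_⟩
    · simp [hf', hg']
    · exact (totalDegree_mul _ _).trans (add_le_add (hd N) (he N))
  add_mem' := by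
    rintro f g ⟨hf, hf', d, hd⟩ ⟨hg, hg', e, he⟩
    refine ⟨fun N => (hf N).add (hg N), fun N => ?_, max d e, fun N => ?_⟩
    · simp [hf', hg']
    · exact (totalDegree_add _ _).trans (max_le_max (hd N) (he N))
  algebraMap_mem' := by
    intro r
    refine ⟨fun N => ?_, fun N => ?_, 0, fun N => ?_⟩
    · exact IsSymmetric.C r
    · simp only [Pi.algebraMap_apply]
      exact (dropLast N).commutes r
    · exact (totalDegree_C r).le

/-! ### Power sums -/

theorem dropLast_psum (N d : ℕ) (hd : 0 < d) :
    dropLast N (psum (Fin (N + 1)) ℂ d) = psum (Fin N) ℂ d := by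
  simp [psum, dropLast, Fin.sum_univ_castSucc, hd.ne']

/-- The power sum symmetric function `p_ν = p_{ν_1} p_{ν_2} ⋯` of a partition `ν`. -/
def powerSum {n : ℕ} (ν : n.Partition) : SymFun :=
  ⟨fun N => psumPart (Fin N) ℂ ν, by
    refine ⟨fun N => ?_, fun N => ?_, n, fun N => ?_⟩
    · refine Subalgebra.multiset_prod_mem (symmetricSubalgebra (Fin N) ℂ)
        (m := ν.parts.map (psum (Fin N) ℂ)) ?_
      intro q hq
      obtain ⟨d, -, rfl⟩ := Multiset.mem_map.1 hq
      exact psum_isSymmetric (Fin N) ℂ d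
    · simp only [psumPart, map_multiset_prod, Multiset.map_map]
      congr 1
      refine Multiset.map_congr rfl fun d hd => ?_
      exact dropLast_psum N d (ν.parts_pos hd)
    · refine (totalDegree_multiset_prod _).trans ?_
      rw [Multiset.map_map]
      conv_rhs => rw [← ν.parts_sum, ← Multiset.map_id ν.parts]
      refine Multiset.sum_map_le_sum_map _ _ fun d _ => ?_
      simp only [Function.comp, psum, id]
      refine totalDegree_finsetSum_le fun i _ => ?_
      exact (totalDegree_X_pow i d).le⟩

/-! ### Schur functions through bialternants -/

/-- The antisymmetrization `ε · x^β = ∑_w sign(w) w · x^β` of a monomial over the symmetric group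
on `N` letters. -/
def alternant {N : ℕ} (β : Fin N → ℕ) : MvPolynomial (Fin N) ℂ :=
  ∑ w : Equiv.Perm (Fin N), (Equiv.Perm.sign w : ℤ) • rename w (∏ j, X j ^ β j)

/-- The staircase `δ = (N - 1, …, 1, 0)`. -/
def staircase (N : ℕ) : Fin N → ℕ := fun j => N - 1 - j

/-- The exponent vector `lam + δ` in `N` variables; `lam.rowLen j` is the part `lam_{j+1}`. -/
def shifted (lam : YoungDiagram) (N : ℕ) : Fin N → ℕ := fun j => lam.rowLen j + staircase N j

theorem alternant_eq_det {N : ℕ} (β : Fin N → ℕ) :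
    alternant β = (Matrix.of fun i j => (X i : MvPolynomial (Fin N) ℂ) ^ β j).det := by
  rw [Matrix.det_apply, alternant]
  refine Finset.sum_congr rfl fun w _ => ?_
  simp [Units.smul_def, map_prod]

theorem alternant_staircase (N : ℕ) : alternant (staircase N) =
    ∏ i : Fin N, ∏ j ∈ Finset.Ioi i, (X i - X j : MvPolynomial (Fin N) ℂ) := by
  have h := Matrix.det_projVandermonde (1 : Fin N → MvPolynomial (Fin N) ℂ) X
  simp only [Pi.one_apply, one_mul] at h
  rw [← h, alternant_eq_det]
  congr 1
  refine Matrix.ext fun i j => ?_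
  simp only [Matrix.of_apply, staircase, Matrix.projVandermonde_apply, Pi.one_apply, one_pow,
    one_mul, Fin.val_rev]
  congr 1
  omega

theorem X_sub_X_dvd_iff {N : ℕ} (i j : Fin N) (f : MvPolynomial (Fin N) ℂ) :
    (X i - X j) ∣ f ↔ aeval (fun k => if k = i then X j else X k) f = (0 : MvPolynomial (Fin N) ℂ) := by
  constructor
  · rintro ⟨g, rfl⟩
    rcases eq_or_ne j i with rfl | h <;> simp [*]
  · intro h
    have key : ∀ g : MvPolynomial (Fin N) ℂ, (X i - X j) ∣
        g - aeval (fun k => if k = i then X j else X k) g := by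
      intro g
      induction g using MvPolynomial.induction_on with
      | C a => simp
      | add p q hp hq =>
        rw [map_add, add_sub_add_comm]
        exact dvd_add hp hq
      | mul_X p k hp =>
        rw [map_mul, aeval_X]
        by_cases hk : k = i
        · subst hk
          rw [if_pos rfl]
          have : p * X k - (aeval fun l => if l = k then X j else X l) p * X j
              = (p - (aeval fun l => if l = k then X j else X l) p) * X k
              + (aeval fun l => if l = k then X j else X l) p * (X k - X j) := by ring
          rw [this]
          exact dvd_add (hp.mul_right _) (Dvd.intro_left _ rfl)
        · rw [if_neg hk, ← sub_mul]
          exact hp.mul_right _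
    have hk := key f
    rwa [h, sub_zero] at hk

theorem X_sub_X_dvd_alternant {N : ℕ} {i j : Fin N} (hij : i ≠ j) (β : Fin N → ℕ) :
    (X i - X j) ∣ alternant β := by
  rw [X_sub_X_dvd_iff, alternant_eq_det, AlgHom.map_det]
  refine Matrix.det_zero_of_row_eq hij ?_
  ext k : 1
  simp [hij.symm]

/-- The antisymmetrization of `x^δ` divides that of every monomial. -/
theorem alternant_dvd {N : ℕ} (β : Fin N → ℕ) : alternant (staircase N) ∣ alternant β := by
  have main : ∀ s : Finset (Σ _ : Fin N, Fin N), (∀ a ∈ s, a.1 < a.2) →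
      (∏ a ∈ s, (X a.1 - X a.2 : MvPolynomial (Fin N) ℂ)) ∣ alternant β := by
    intro s
    induction s using Finset.induction_on with
    | empty => simp
    | insert a s ha ih =>
      intro hs
      obtain ⟨g, hg⟩ := ih fun b hb => hs b (Finset.mem_insert_of_mem hb)
      have hlt := hs a (Finset.mem_insert_self _ _)
      have hd := X_sub_X_dvd_alternant hlt.ne β
      rw [X_sub_X_dvd_iff, hg, map_mul, mul_eq_zero, map_prod, Finset.prod_eq_zero_iff] at hd
      rcases hd with ⟨b, hb, h0⟩ | hd
      · exfalso
        have hbl := hs b (Finset.mem_insert_of_mem hb)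
        simp only [map_sub, aeval_X] at h0
        have hne : a ≠ b := fun h => ha (h ▸ hb)
        rw [sub_eq_zero] at h0
        obtain ⟨a1, a2⟩ := a
        obtain ⟨b1, b2⟩ := b
        simp only at h0 hlt hbl
        split_ifs at h0 with h1 h2 h2
        · exact hbl.ne (h1.trans h2.symm)
        · have := X_injective h0
          subst h1 this
          exact hne rfl
        · have := X_injective h0
          subst h2 this
          exact absurd hlt (not_lt.2 hbl.le)
        · exact hbl.ne (X_injective h0)
      · rw [← X_sub_X_dvd_iff] at hd
        rw [Finset.prod_insert ha, mul_comm, hg]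
        exact mul_dvd_mul_left _ hd
  rw [alternant_staircase, Finset.prod_sigma']
  refine main _ fun a ha => ?_
  simpa using ha

theorem alternant_staircase_ne_zero (N : ℕ) : alternant (staircase N) ≠ 0 := by
  rw [alternant_staircase, Finset.prod_ne_zero_iff]
  intro i _
  rw [Finset.prod_ne_zero_iff]
  intro j hj h
  exact (Finset.mem_Ioi.1 hj).ne (X_injective (sub_eq_zero.1 h))

/-- The Schur polynomial `s_lam(x_1, …, x_N) = (ε · x^{lam + δ}) / (ε · x^δ)` for `N ≥ ℓ(lam)`, and
zero for `N < ℓ(lam)`; the number of rows `ℓ(lam)` is `lam.colLen 0`. -/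
def schurPoly (lam : YoungDiagram) (N : ℕ) : MvPolynomial (Fin N) ℂ :=
  if lam.colLen 0 ≤ N then (alternant_dvd (shifted lam N)).choose else 0

theorem schurPoly_spec (lam : YoungDiagram) (N : ℕ) (h : lam.colLen 0 ≤ N) :
    alternant (shifted lam N) = alternant (staircase N) * schurPoly lam N := by
  rw [schurPoly, if_pos h]
  exact (alternant_dvd (shifted lam N)).choose_spec

theorem rename_alternant {N : ℕ} (β : Fin N → ℕ) (e : Equiv.Perm (Fin N)) :
    rename e (alternant β) = (Equiv.Perm.sign e : ℤ) • alternant β := by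
  simp only [alternant, map_sum, map_zsmul, rename_rename, Finset.smul_sum, smul_smul]
  refine Fintype.sum_equiv (Equiv.mulLeft e) _ _ fun w => ?_
  simp only [Equiv.coe_mulLeft, Equiv.Perm.coe_mul, Equiv.Perm.sign_mul, Units.val_mul]
  rw [← mul_assoc, ← Units.val_mul, Int.units_mul_self, Units.val_one, one_mul]

theorem schurPoly_isSymmetric (lam : YoungDiagram) (N : ℕ) : (schurPoly lam N).IsSymmetric := by
  by_cases h : lam.colLen 0 ≤ N
  · intro e
    have h1 := congrArg (rename e) (schurPoly_spec lam N h)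
    rw [map_mul, rename_alternant, rename_alternant, schurPoly_spec lam N h, smul_mul_assoc] at h1
    have h2 := congrArg (fun f => (Equiv.Perm.sign e : ℤ) • f) h1
    simp only [smul_smul, ← Units.val_mul, Int.units_mul_self, Units.val_one, one_smul] at h2
    exact (mul_left_cancel₀ (alternant_staircase_ne_zero N) h2).symm
  · rw [schurPoly, if_neg h]
    exact IsSymmetric.zero

theorem dropLast_alternant_of_pos {N : ℕ} (β : Fin (N + 1) → ℕ) (h : ∀ j, 0 < β j) :
    dropLast N (alternant β) = 0 := by
  rw [alternant_eq_det, AlgHom.map_det]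
  refine Matrix.det_eq_zero_of_row_eq_zero (Fin.last N) fun j => ?_
  simp [dropLast, (h j).ne']

theorem dropLast_alternant {N : ℕ} (β : Fin (N + 1) → ℕ) (γ : Fin N → ℕ)
    (h0 : β (Fin.last N) = 0) (h : ∀ j : Fin N, β j.castSucc = γ j + 1) :
    dropLast N (alternant β) = (∏ i, X i) * alternant γ := by
  rw [alternant_eq_det, alternant_eq_det, AlgHom.map_det, Matrix.det_succ_row _ (Fin.last N),
    Fin.sum_univ_castSucc, ← Matrix.det_mul_column]
  rw [Finset.sum_eq_zero]
  · simp only [zero_add, AlgHom.mapMatrix_apply, Matrix.map_apply, Matrix.of_apply, h0, pow_zero,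
      ← two_mul, Fin.val_last, pow_mul, neg_one_sq, one_pow, one_mul, map_one]
    refine congrArg Matrix.det ?_
    refine Matrix.ext fun i j => ?_
    simp [dropLast, h, pow_succ']
  · intro j _
    have hj : β j.castSucc ≠ 0 := by rw [h]; omega
    simp [dropLast, hj]

theorem shifted_last (lam : YoungDiagram) (N : ℕ) (h : lam.colLen 0 ≤ N) :
    shifted lam (N + 1) (Fin.last N) = 0 := by
  have : lam.rowLen N = 0 := by
    by_contra h0
    have h1 : (N, 0) ∈ lam := YoungDiagram.mem_iff_lt_rowLen.2 (Nat.pos_of_ne_zero h0)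
    exact absurd (YoungDiagram.mem_iff_lt_colLen.1 h1) (not_lt.2 h)
  simp [shifted, staircase, this]

theorem schurPoly_stable (lam : YoungDiagram) (N : ℕ) :
    dropLast N (schurPoly lam (N + 1)) = schurPoly lam N := by
  have hst : dropLast N (alternant (staircase (N + 1))) =
      (∏ i, X i) * alternant (staircase N) := by
    refine dropLast_alternant _ _ (by simp [staircase]) fun j => ?_
    simp only [staircase, Fin.val_castSucc]
    omega
  have hX : (∏ i, X i : MvPolynomial (Fin N) ℂ) ≠ 0 :=
    Finset.prod_ne_zero_iff.2 fun i _ => X_ne_zero i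
  have hne := mul_ne_zero hX (alternant_staircase_ne_zero N)
  by_cases h : lam.colLen 0 ≤ N
  · have h1 := congrArg (dropLast N) (schurPoly_spec lam (N + 1) (h.trans N.le_succ))
    rw [map_mul, hst, dropLast_alternant _ (shifted lam N) (shifted_last lam N h),
      schurPoly_spec lam N h, ← mul_assoc] at h1
    · exact (mul_left_cancel₀ hne h1).symm
    · intro j
      simp only [shifted, staircase, Fin.val_castSucc]
      omega
  · by_cases h' : lam.colLen 0 ≤ N + 1
    · have h1 := congrArg (dropLast N) (schurPoly_spec lam (N + 1) h')
      rw [map_mul, hst, dropLast_alternant_of_pos] at h1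
      · rw [schurPoly.eq_def lam N, if_neg h]
        exact (mul_eq_zero.1 h1.symm).resolve_left hne
      · intro j
        have h2 : (j.val, 0) ∈ lam := YoungDiagram.mem_iff_lt_colLen.2 (by omega)
        have h3 := YoungDiagram.mem_iff_lt_rowLen.1 h2
        simp only [shifted]
        omega
    · rw [schurPoly.eq_def lam N, schurPoly.eq_def lam (N + 1), if_neg h, if_neg h', map_zero]

theorem alternant_isHomogeneous {N : ℕ} (β : Fin N → ℕ) :
    (alternant β).IsHomogeneous (∑ j, β j) := by
  refine IsHomogeneous.sum _ _ _ fun w _ => ?_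
  have h : (∏ j, X j ^ β j : MvPolynomial (Fin N) ℂ).IsHomogeneous (∑ j, β j) :=
    IsHomogeneous.prod _ _ _ fun j _ => by simpa using (isHomogeneous_X ℂ j).pow (β j)
  rcases Int.units_eq_one_or (Equiv.Perm.sign w) with hw | hw
  · simpa [hw] using h.rename_isHomogeneous (f := w)
  · simpa [hw] using (h.rename_isHomogeneous (f := w)).neg

theorem totalDegree_schurPoly_le (lam : YoungDiagram) (N : ℕ) :
    (schurPoly lam N).totalDegree ≤ lam.card := by
  by_cases h : lam.colLen 0 ≤ N
  · by_cases h0 : schurPoly lam N = 0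
    · simp [h0]
    have h1 := totalDegree_mul_of_isDomain (alternant_staircase_ne_zero N) h0
    rw [← schurPoly_spec lam N h,
      (alternant_isHomogeneous (staircase N)).totalDegree (alternant_staircase_ne_zero N)] at h1
    have h2 := (alternant_isHomogeneous (shifted lam N)).totalDegree_le
    simp only [shifted, Finset.sum_add_distrib] at h2
    have h3 : ∑ j : Fin N, lam.rowLen j ≤ lam.card := by
      rw [Fin.sum_univ_eq_sum_range (fun j => lam.rowLen j) N]
      simp only [YoungDiagram.rowLen_eq_card, YoungDiagram.row]
      rw [← Finset.card_biUnion]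
      · refine Finset.card_le_card fun c hc => ?_
        obtain ⟨j, -, hc⟩ := Finset.mem_biUnion.1 hc
        exact (Finset.mem_filter.1 hc).1
      · intro a _ b _ hab
        refine Finset.disjoint_left.2 fun c hc hc' => hab ?_
        exact (Finset.mem_filter.1 hc).2.symm.trans (Finset.mem_filter.1 hc').2
    omega
  · simp [schurPoly, h]

/-- The Schur function `s_lam`, the limit of the polynomials `s_lam(x_1, …, x_N)`. -/
def schur (lam : YoungDiagram) : SymFun :=
  ⟨fun N => schurPoly lam N, schurPoly_isSymmetric lam, schurPoly_stable lam, lam.card,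
    totalDegree_schurPoly_le lam⟩

/-! ### Atomic symmetric functions and path power sums -/

/-- A partial permutation `(I, J)` of `[n]`: two families of distinct elements of `[n]` with a common
index set. -/
structure PartialPerm (n : ℕ) (ι : Type) where
  I : ι ↪ Fin n
  J : ι ↪ Fin n

open Classical in
/-- The indicator function `1_{I,J}` of the permutations `w` with `w(I) = J`. -/
def PartialPerm.indicator {n : ℕ} {ι : Type} (P : PartialPerm n ι) (w : Equiv.Perm (Fin n)) : ℂ :=
  if ∀ a, w (P.I a) = P.J a then 1 else 0

/-- The Reynolds operator `(R f)(w) = (1 / n!) ∑_v f(v⁻¹ w v)`. -/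
def reynolds {n : ℕ} (f : Equiv.Perm (Fin n) → ℂ) (w : Equiv.Perm (Fin n)) : ℂ :=
  (1 / (n.factorial : ℂ)) * ∑ v : Equiv.Perm (Fin n), f (v⁻¹ * w * v)

/-- The Frobenius characteristic `ch_n(f) = (1 / n!) ∑_w f(w) p_{cyc(w)}`; here `w.partition` is the
cycle type of `w`, fixed points included. -/
def frobenius {n : ℕ} (f : Equiv.Perm (Fin n) → ℂ) : SymFun :=
  (1 / (n.factorial : ℂ)) • ∑ w : Equiv.Perm (Fin n), f w • powerSum w.partition

/-- The atomic symmetric function `A_{n,I,J} = n! ch_n(R 1_{I,J})`. -/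
def PartialPerm.atomic {n : ℕ} {ι : Type} (P : PartialPerm n ι) : SymFun :=
  (n.factorial : ℂ) • frobenius (reynolds P.indicator)

/-- A partial permutation whose graph is the disjoint union of directed paths with `α_1, α_2, …`
vertices. The vertices of the `i`-th path are `(i, 0) → (i, 1) → ⋯ → (i, α_i - 1)`, and they are
labelled by `[n]`, `n = ∑ α_i`, path after path. -/
def pathPartialPerm (α : List ℕ) :
    PartialPerm (∑ i : Fin α.length, α.get i) (Σ i : Fin α.length, Fin (α.get i - 1)) where
  I := ⟨fun a => finSigmaFinEquiv ⟨a.1, ⟨a.2, by have := a.2.2; omega⟩⟩, by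
    rintro ⟨i, a⟩ ⟨j, b⟩ h
    have h := finSigmaFinEquiv.injective h
    simp only [Sigma.mk.injEq] at h
    obtain ⟨rfl, h⟩ := h
    simpa [Fin.ext_iff] using h⟩
  J := ⟨fun a => finSigmaFinEquiv ⟨a.1, ⟨a.2 + 1, by have := a.2.2; omega⟩⟩, by
    rintro ⟨i, a⟩ ⟨j, b⟩ h
    have h := finSigmaFinEquiv.injective h
    simp only [Sigma.mk.injEq] at h
    obtain ⟨rfl, h⟩ := h
    simpa [Fin.ext_iff] using h⟩

/-- The path power sum of a partition `ν`: the atomic symmetric function of the disjoint union of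
directed paths on `ν_1, ν_2, …` vertices. -/
def pathPowerSum {n : ℕ} (ν : n.Partition) : SymFun :=
  (pathPartialPerm (ν.parts.sort (· ≥ ·))).atomic

/-! ### Partitions -/

/-- `μ(n) = (μ_1, …, μ_r, 1^{n - |μ|})` for `n ≥ |μ|`. -/
def padOnes {m : ℕ} (μ : m.Partition) (n : ℕ) (h : m ≤ n) : n.Partition where
  parts := μ.parts + Multiset.replicate (n - m) 1
  parts_pos := by
    intro i hi
    rcases Multiset.mem_add.1 hi with hi | hi
    · exact μ.parts_pos hi
    · rw [Multiset.eq_of_mem_replicate hi]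
      exact Nat.one_pos
  parts_sum := by
    rw [Multiset.sum_add, μ.parts_sum, Multiset.sum_replicate, smul_eq_mul, mul_one]
    omega

/-- `m(μ)! = ∏_i m_i(μ)!`, where `m_i(μ)` is the number of parts of `μ` equal to `i`. -/
def multFactorial {m : ℕ} (μ : m.Partition) : ℕ :=
  ∏ i ∈ μ.parts.toFinset, (μ.parts.count i).factorial

/-! ### Ribbons and monotonic ribbon tilings

Boxes are pairs `(row, column)`, both counted from `0`, with row `0` on top. -/

/-- A ribbon: an edgewise connected (in particular nonempty) skew diagram without `2 × 2` square.
The Hasse graph of the product order on `ℕ × ℕ` joins two boxes when they share an edge. -/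
def IsRibbon (ξ : Finset (ℕ × ℕ)) : Prop :=
  (∃ lam rho : YoungDiagram, rho ≤ lam ∧ ξ = lam.cells \ rho.cells) ∧
  ((SimpleGraph.hasse (ℕ × ℕ)).induce (ξ : Set (ℕ × ℕ))).Connected ∧
  ∀ i j, ¬ ((i, j) ∈ ξ ∧ (i, j + 1) ∈ ξ ∧ (i + 1, j) ∈ ξ ∧ (i + 1, j + 1) ∈ ξ)

/-- The height: the number of rows occupied, less one. -/
def height (ξ : Finset (ℕ × ℕ)) : ℕ := (ξ.image Prod.fst).card - 1

/-- The row of the tail, i.e. the lowest row occupied. -/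
def tailRow (ξ : Finset (ℕ × ℕ)) : ℕ := ξ.sup Prod.fst

/-- The column of the tail, the southwesternmost box: it is the leftmost box of the lowest row. -/
def tailCol (ξ : Finset (ℕ × ℕ)) : ℕ := sInf {j | (tailRow ξ, j) ∈ ξ}

/-- The union of a list of sets of boxes. -/
def unionCells (l : List (Finset (ℕ × ℕ))) : Finset (ℕ × ℕ) := l.foldr (· ∪ ·) ∅

/-- A monotonic ribbon tiling of a shape, recorded as the list of its ribbons from left to right. -/
@[ext]
structure MonotonicTiling where
  shape : YoungDiagram
  ribbons : List (Finset (ℕ × ℕ))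
  isRibbon : ∀ ξ ∈ ribbons, IsRibbon ξ
  disjoint : ribbons.Pairwise Disjoint
  union_eq : unionCells ribbons = shape.cells
  tails_lt : (ribbons.map tailCol).Pairwise (· < ·)
  initial : ∀ i ≤ ribbons.length, ∃ ν : YoungDiagram, unionCells (ribbons.take i) = ν.cells

namespace MonotonicTiling

/-- The sign: the product of the signs `(-1)^{ht(ξ)}` of the ribbons. -/
def sign (T : MonotonicTiling) : ℤ := (T.ribbons.map fun ξ => (-1) ^ height ξ).prod

/-- `ρ_i(T)`: the number of ribbons of size `i`. -/
def rho (T : MonotonicTiling) (i : ℕ) : ℕ := (T.ribbons.map Finset.card).count i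

/-- `T` is frozen if no ribbon of `T` has its tail in the first row. -/
def IsFrozen (T : MonotonicTiling) : Prop := ∀ ξ ∈ T.ribbons, tailRow ξ ≠ 0

end MonotonicTiling

/-- The diagram obtained from `lam` by adding `n - |lam|` boxes to its first row. -/
def extendFirstRow (lam : YoungDiagram) (n : ℕ) : YoungDiagram where
  cells := lam.cells ∪ {0} ×ˢ Finset.range (lam.rowLen 0 + (n - lam.card))
  isLowerSet := by
    rintro ⟨i, j⟩ ⟨i', j'⟩ ⟨hi, hj⟩ h
    simp only [Finset.coe_union, Set.mem_union, Finset.mem_coe, Finset.mem_product,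
      Finset.mem_singleton, Finset.mem_range, YoungDiagram.mem_cells] at h ⊢
    simp only at hi hj
    rcases h with h | ⟨rfl, h⟩
    · exact Or.inl (lam.up_left_mem hi hj h)
    · exact Or.inr ⟨by omega, by omega⟩

/-- `σ(T, n)`: the shape of `T` with `n - |shape(T)|` boxes added to its first row. -/
def sigma (T : MonotonicTiling) (n : ℕ) : YoungDiagram := extendFirstRow T.shape n

/-- The frozen monotonic ribbon tilings with at most `n - |μ|` ribbons of size `1` and at most
`m_i(μ)` ribbons of size `i` for every `i > 1`. -/
def frozenTilings {m : ℕ} (μ : m.Partition) (n : ℕ) : Set MonotonicTiling :=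
  {T | T.IsFrozen ∧ m + T.rho 1 ≤ n ∧ ∀ i > 1, T.rho i ≤ μ.parts.count i}

/-- The multinomial coefficient with upper entry `n - |μ| + ℓ(μ) - ρ(T)` and lower entries
`n - |μ| - ρ_1(T)` and `m_i(μ) - ρ_i(T)` for `i > 1` (these vanish for `i > |μ|`). For `T` in
`frozenTilings μ n` no subtraction is truncated, the upper entry is the sum of the lower ones, and
the division is exact. -/
def coefficient {m : ℕ} (μ : m.Partition) (n : ℕ) (T : MonotonicTiling) : ℕ :=
  (n - m + μ.parts.card - T.ribbons.length).factorial /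
    ((n - m - T.rho 1).factorial * ∏ i ∈ Finset.Icc 2 m, (μ.parts.count i - T.rho i).factorial)

end PathPower

end

noncomputable section

namespace PathPower

open MvPolynomial

/-! Averaging over conjugates does not affect cycle types, so an atomic symmetric function is the
sum of `p_{cyc(w)}` over the extensions `w` of the partial permutation. In finitely many variables,
`p_{cyc(w)}` enumerates the colourings constant on the cycles of `w`. After exchanging the sums,
only colourings constant on the paths survive, and such a colouring is preserved by `∏ k!`
extensions, with `k` running over the numbers of paths of each colour. A path power sum thus
enumerates the ways to write all paths as letters of words attached to the variables
(`pathPartialPerm_atomic_apply`).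

Multiplication by the alternant of `δ` turns this into a sum of alternants, evaluated letter by
letter: take a letter off the word of the largest variable `x_i` with a nonempty word
(`transfer_Iic`). The remaining letters may still go to any of `x_0, …, x_i`, so their sum is
antisymmetric in the first `i + 1` exponents. It vanishes if the removed letter makes two of these
collide (`transfer_eq_zero_of_no_step`); otherwise sorting them adds a ribbon with tail in row `i`,
at the cost of its sign (`transfer_ribbonStep`). Iteration gives ribbons whose tails rise weakly,
which is the same as tail columns increasing strictly (`RibbonStep.tail_lt_iff`). Once only `x_0`
receives letters, they all lengthen the first row: this is why only frozen tilings occur, and why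
the shape is `σ(T, n)`. Counting the choices of letters with prescribed sizes (`labelings`) gives
the multinomial coefficient.

For the two bounds, the tails of a frozen tiling occupy distinct columns that meet the second row,
so the number of ribbons is at most the length of that row (`length_le_rowLen`). This is compared
with the sum and the number of the parts not used by the tiling. -/

/-! ### Power sums as generating functions of colourings -/

theorem apply_eq_of_sameCycle {α κ : Type*} [Finite α] {w : Equiv.Perm α} {g : α → κ} (hg : g ∘ w = g) {a b : α}
    (h : w.SameCycle a b) : g a = g b := by
  obtain ⟨k, rfl⟩ := h.exists_nat_pow_eq
  clear h
  induction k with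
  | zero => rfl
  | succ k ih =>
    rw [pow_succ', Equiv.Perm.mul_apply]
    exact ih.trans (congrFun hg _).symm

section Cycles

variable {α : Type*} [Fintype α] [DecidableEq α]

open Classical in
/-- A product over the cycle type of `w`, fixed points included, is a product over the orbits. -/
theorem prod_parts_partition {R : Type*} [CommMonoid R] (w : Equiv.Perm α) (F : ℕ → R) :
    (w.partition.parts.map F).prod =
      ∏ q : Quotient (Equiv.Perm.SameCycle.setoid w),
        F (Finset.univ.filter fun a => Quotient.mk (Equiv.Perm.SameCycle.setoid w) a = q).card := by
  classical
  set s := Equiv.Perm.SameCycle.setoid w with hs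
  have hq : ∀ a b : α, (Quotient.mk s a = Quotient.mk s b) ↔ w.SameCycle a b := fun a b =>
    Quotient.eq
  let L : Quotient s → Equiv.Perm α := Quotient.lift (fun a => w.cycleOf a)
    fun a b h => Equiv.Perm.SameCycle.cycleOf_eq h
  have hL : ∀ a, L (Quotient.mk s a) = w.cycleOf a := fun a => rfl
  -- The parts of `w.partition` are the lengths of the nontrivial cycles followed by a one for each
  -- fixed point; the orbits split in the same way, `L q = 1` marking the fixed points.
  rw [Equiv.Perm.parts_partition, Multiset.map_add, Multiset.prod_add,
    ← Finset.prod_filter_mul_prod_filter_not Finset.univ (fun q => L q ≠ 1)]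
  congr 1
  · rw [Equiv.Perm.cycleType_def, Multiset.map_map]
    change ∏ c ∈ w.cycleFactorsFinset, (F ∘ Finset.card ∘ Equiv.Perm.support) c = _
    symm
    refine Finset.prod_bij (fun q _ => L q) ?_ ?_ ?_ ?_
    · intro q
      induction q using Quotient.inductionOn with | _ a => ?_
      intro h
      rw [Finset.mem_filter] at h
      refine Equiv.Perm.cycleOf_mem_cycleFactorsFinset_iff.2 ?_
      rw [Equiv.Perm.mem_support]
      exact fun h' => h.2 ((Equiv.Perm.cycleOf_eq_one_iff w).2 h')
    · intro q hq1 q' hq2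
      induction q using Quotient.inductionOn with | _ a => ?_
      induction q' using Quotient.inductionOn with | _ b => ?_
      intro h
      rw [hL, hL] at h
      rw [Finset.mem_filter, hL] at hq1
      rw [hq]
      have h1 : a ∈ (w.cycleOf a).support := by
        rw [Equiv.Perm.mem_support, Equiv.Perm.cycleOf_apply_self]
        exact fun h' => hq1.2 ((Equiv.Perm.cycleOf_eq_one_iff w).2 h')
      rw [h, Equiv.Perm.mem_support_cycleOf_iff] at h1
      exact h1.1.symm
    · intro c hc
      obtain ⟨hc1, hc2⟩ := Equiv.Perm.mem_cycleFactorsFinset_iff.1 hc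
      obtain ⟨a, ha, -⟩ := id hc1
      have hca := Equiv.Perm.cycle_is_cycleOf (Equiv.Perm.mem_support.2 ha) hc
      refine ⟨Quotient.mk s a, ?_, hca.symm⟩
      rw [Finset.mem_filter, hL, ← hca]
      exact ⟨Finset.mem_univ _, hc1.ne_one⟩
    · intro q
      induction q using Quotient.inductionOn with | _ a => ?_
      intro h
      rw [Finset.mem_filter, hL] at h
      simp only [Function.comp, hL]
      congr 2
      ext b
      rw [Finset.mem_filter, hq, Equiv.Perm.mem_support_cycleOf_iff, Equiv.Perm.mem_support]
      have h1 : w a ≠ a := fun h' => h.2 ((Equiv.Perm.cycleOf_eq_one_iff w).2 h')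
      constructor
      · rintro ⟨-, h⟩
        exact ⟨h.symm, h1⟩
      · rintro ⟨h, -⟩
        exact ⟨Finset.mem_univ _, h.symm⟩
  · have hcard : Fintype.card α - w.support.card = (Finset.univ.filter fun a => w a = a).card := by
      rw [← Finset.card_compl]
      congr 1
      ext a
      simp
    rw [hcard, Multiset.map_replicate, Multiset.prod_replicate, ← Finset.prod_const]
    refine Finset.prod_bij (fun a _ => Quotient.mk s a) ?_ ?_ ?_ ?_
    · intro a ha
      rw [Finset.mem_filter] at ha
      rw [Finset.mem_filter, hL, not_not, Equiv.Perm.cycleOf_eq_one_iff]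
      exact ⟨Finset.mem_univ _, ha.2⟩
    · intro a ha b hb h
      rw [Finset.mem_filter] at ha
      rw [hq] at h
      exact h.eq_of_left ha.2
    · intro q
      induction q using Quotient.inductionOn with | _ a => ?_
      intro h
      rw [Finset.mem_filter, hL, not_not, Equiv.Perm.cycleOf_eq_one_iff] at h
      exact ⟨a, by simpa using h.2, rfl⟩
    · intro a ha
      rw [Finset.mem_filter] at ha
      congr 1
      rw [eq_comm, Finset.card_eq_one]
      refine ⟨a, ?_⟩
      ext b
      rw [Finset.mem_filter, hq, Finset.mem_singleton]
      constructor
      · rintro ⟨-, h⟩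
        exact h.eq_of_right ha.2
      · rintro rfl
        exact ⟨Finset.mem_univ _, Equiv.Perm.SameCycle.refl _ _⟩

/-- The power sum of the cycle type of `w` counts the colourings that are constant on the cycles
of `w`. -/
theorem prod_parts_eq_sum_colorings {κ R : Type*} [Fintype κ] [DecidableEq κ] [CommSemiring R]
    (w : Equiv.Perm α) (x : κ → R) :
    (w.partition.parts.map fun d => ∑ i, x i ^ d).prod =
      ∑ g : α → κ with g ∘ w = g, ∏ a, x (g a) := by
  classical
  rw [prod_parts_partition w fun d => ∑ i, x i ^ d, Finset.prod_univ_sum]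
  refine Finset.sum_bij (fun h _ a => h (Quotient.mk (Equiv.Perm.SameCycle.setoid w) a)) ?_ ?_ ?_ ?_
  · intro h _
    rw [Finset.mem_filter]
    refine ⟨Finset.mem_univ _, funext fun a => congrArg h (Quotient.sound ?_)⟩
    exact (Equiv.Perm.sameCycle_apply_left).2 (Equiv.Perm.SameCycle.refl _ _)
  · intro h _ h' _ heq
    funext q
    induction q using Quotient.inductionOn with | _ a => ?_
    exact congrFun heq a
  · intro g hg
    rw [Finset.mem_filter] at hg
    refine ⟨Quotient.lift g fun a b hab => apply_eq_of_sameCycle hg.2 hab, ?_, rfl⟩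
    simp
  · intro h _
    rw [← Finset.prod_fiberwise Finset.univ (Quotient.mk (Equiv.Perm.SameCycle.setoid w))]
    refine Finset.prod_congr rfl fun q _ => ?_
    rw [← Finset.prod_const]
    refine Finset.prod_congr rfl fun a ha => ?_
    exact congrArg (fun q => x (h q)) (Finset.mem_filter.1 ha).2.symm

end Cycles

theorem powerSum_partition_apply {n : ℕ} (w : Equiv.Perm (Fin n)) (N : ℕ) :
    (powerSum w.partition).1 N =
      ∑ g : Fin n → Fin N with g ∘ w = g, ∏ a, (X (g a) : MvPolynomial (Fin N) ℂ) :=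
  prod_parts_eq_sum_colorings w X

theorem partition_conj {n : ℕ} (v w : Equiv.Perm (Fin n)) :
    (v⁻¹ * w * v).partition = w.partition :=
  Equiv.Perm.partition_eq_of_isConj.1
    (isConj_iff.2 ⟨v, by group⟩)

/-- The atomic symmetric function is the cycle index of the extensions of the partial
permutation. -/
theorem PartialPerm.atomic_eq_sum {n : ℕ} {ι : Type} (P : PartialPerm n ι) :
    P.atomic = ∑ w : Equiv.Perm (Fin n), P.indicator w • powerSum w.partition := by
  have hn : (n.factorial : ℂ) ≠ 0 := Nat.cast_ne_zero.2 n.factorial_ne_zero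
  rw [PartialPerm.atomic, frobenius, smul_smul, mul_one_div_cancel hn, one_smul]
  simp only [reynolds, mul_smul, Finset.sum_smul]
  rw [← Finset.smul_sum, Finset.sum_comm]
  -- Reindexing by conjugation keeps the cycle type, so each of the `n!` inner sums equals the one
  -- for `v = 1`.
  have : ∀ v : Equiv.Perm (Fin n),
      ∑ w : Equiv.Perm (Fin n), P.indicator (v⁻¹ * w * v) • powerSum w.partition =
        ∑ w : Equiv.Perm (Fin n), P.indicator w • powerSum w.partition := by
    intro v
    refine Fintype.sum_equiv (MulAut.conj v⁻¹).toEquiv _ _ fun w => ?_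
    simp only [MulEquiv.toEquiv_eq_coe, EquivLike.coe_coe, MulAut.conj_apply, inv_inv,
      partition_conj]
  rw [Finset.sum_congr rfl fun v _ => this v, Finset.sum_const,
    show (Finset.univ : Finset (Equiv.Perm (Fin n))).card = n.factorial by
      rw [Finset.card_univ, Fintype.card_perm, Fintype.card_fin], ← Nat.cast_smul_eq_nsmul ℂ, smul_smul, one_div_mul_cancel hn, one_smul]

/-! ### Monomial expansion of path power sums -/

section Blocks

variable {A ι κ : Type*} [Fintype A] [DecidableEq A] [Fintype ι] [DecidableEq ι] [Fintype κ]
  [DecidableEq κ] (st : ι ↪ A) (bl : A → ι) (w₀ : Equiv.Perm A)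

open Classical in
/-- The permutations that agree with `w₀` wherever `w₀` does not hit the start of a block and
that preserve a colouring of the blocks correspond to the permutations of the blocks that preserve
it. -/
theorem card_extensions_eq (hst : ∀ i, bl (st i) = i) (hbl : ∀ a, bl (w₀ a) = bl a) (f : ι → κ) :
    (Finset.univ.filter fun w : Equiv.Perm A =>
      (∀ a, w₀ a ∉ Set.range st → w a = w₀ a) ∧ (f ∘ bl) ∘ w = f ∘ bl).card =
      ∏ k, (Finset.univ.filter fun i => f i = k).card.factorial := by
  have h1 := DomMulAct.stabilizer_card f
  simp only [Fintype.card_subtype] at h1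
  rw [← h1]
  symm
  refine Finset.card_bij (fun σ _ => σ.viaEmbedding st * w₀) ?_ ?_ ?_
  · intro σ hσ
    rw [Finset.mem_filter] at hσ ⊢
    refine ⟨Finset.mem_univ _, fun a ha => Equiv.Perm.viaEmbedding_apply_of_notMem _ _ _ ha, ?_⟩
    funext a
    simp only [Function.comp, Equiv.Perm.mul_apply]
    rw [← hbl a]
    generalize w₀ a = b
    by_cases hb : b ∈ Set.range st
    · obtain ⟨i, rfl⟩ := hb
      rw [Equiv.Perm.viaEmbedding_apply, hst, hst]
      exact congrFun hσ.2 i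
    · rw [Equiv.Perm.viaEmbedding_apply_of_notMem _ _ _ hb]
  · intro σ _ τ _ h
    exact Equiv.Perm.viaEmbeddingHom_injective st (mul_right_cancel h)
  · intro w hw
    rw [Finset.mem_filter] at hw
    obtain ⟨-, hw, hf⟩ := hw
    -- The correction `u` fixes all points that are not block starts, hence permutes the block
    -- starts. The permutation it induces on the blocks is the preimage of `w`.
    set u := w * w₀⁻¹ with hu
    have hfix : ∀ b, b ∉ Set.range st → u b = b := by
      intro b hb
      have := hw (w₀⁻¹ b) (by simpa using hb)
      simpa [hu] using this
    have hmem : ∀ i, u (st i) = st (bl (u (st i))) := by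
      intro i
      by_cases h : u (st i) ∈ Set.range st
      · obtain ⟨j, hj⟩ := h
        rw [← hj, hst]
      · exact absurd ⟨i, (u.injective (hfix _ h)).symm⟩ h
    have hfix' : ∀ b, b ∉ Set.range st → u⁻¹ b = b := by
      intro b hb
      rw [Equiv.Perm.inv_eq_iff_eq, hfix b hb]
    have hmem' : ∀ i, u⁻¹ (st i) = st (bl (u⁻¹ (st i))) := by
      intro i
      by_cases h : u⁻¹ (st i) ∈ Set.range st
      · obtain ⟨j, hj⟩ := h
        rw [← hj, hst]
      · exact absurd ⟨i, (u⁻¹.injective (hfix' _ h)).symm⟩ h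
    let σ : Equiv.Perm ι :=
      { toFun := fun i => bl (u (st i))
        invFun := fun i => bl (u⁻¹ (st i))
        left_inv := fun i => by
          change bl (u⁻¹ (st (bl (u (st i))))) = i
          rw [← hmem, show ∀ b, u⁻¹ (u b) = b from u.symm_apply_apply, hst]
        right_inv := fun i => by
          change bl (u (st (bl (u⁻¹ (st i))))) = i
          rw [← hmem', show ∀ b, u (u⁻¹ b) = b from u.apply_symm_apply, hst] }
    refine ⟨σ, ?_, ?_⟩
    · rw [Finset.mem_filter]
      refine ⟨Finset.mem_univ _, funext fun i => ?_⟩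
      have := congrFun hf (w₀⁻¹ (st i))
      have h2 := hbl (w₀⁻¹ (st i))
      rw [show ∀ b, w₀ (w₀⁻¹ b) = b from w₀.apply_symm_apply, hst] at h2
      simp only [Function.comp] at this
      rw [← h2] at this
      exact this
    · have : σ.viaEmbedding st = u := by
        ext b
        by_cases hb : b ∈ Set.range st
        · obtain ⟨i, rfl⟩ := hb
          rw [Equiv.Perm.viaEmbedding_apply, hmem]
          rfl
        · rw [Equiv.Perm.viaEmbedding_apply_of_notMem _ _ _ hb, hfix b hb]
      rw [this, hu, inv_mul_cancel_right]

open Classical in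
-- Exchange the two sums: a colouring preserved by some extension is constant on the blocks, by
-- `hconst`, and the number of extensions that preserve it is given by `card_extensions_eq`.
theorem sum_extensions_colorings {R : Type*} [CommSemiring R] (hst : ∀ i, bl (st i) = i)
    (hbl : ∀ a, bl (w₀ a) = bl a)
    (hconst : ∀ g : A → κ, (∀ a, w₀ a ∉ Set.range st → g (w₀ a) = g a) → g = (g ∘ st) ∘ bl)
    (F : (A → κ) → R) :
    (∑ w : Equiv.Perm A with ∀ a, w₀ a ∉ Set.range st → w a = w₀ a,
      ∑ g : A → κ with g ∘ w = g, F g) =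
      ∑ f : ι → κ, (∏ k, (Finset.univ.filter fun i => f i = k).card.factorial) • F (f ∘ bl) := by
  simp only [Finset.sum_filter (p := fun g : A → κ => _)]
  rw [Finset.sum_comm]
  have h1 : ∀ g : A → κ, (∑ w : Equiv.Perm A with ∀ a, w₀ a ∉ Set.range st → w a = w₀ a,
      if g ∘ w = g then F g else 0) = (Finset.univ.filter fun w : Equiv.Perm A =>
      (∀ a, w₀ a ∉ Set.range st → w a = w₀ a) ∧ g ∘ w = g).card • F g := by
    intro g
    rw [← Finset.sum_filter, Finset.filter_filter, Finset.sum_const]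
  simp only [h1]
  have hinj : Function.Injective fun f : ι → κ => f ∘ bl := by
    intro f f' h
    funext i
    have := congrFun h (st i)
    simpa [hst] using this
  symm
  rw [← Finset.sum_subset (Finset.subset_univ (Finset.univ.image fun f : ι → κ => f ∘ bl)),
    Finset.sum_image fun f _ f' _ h => hinj h]
  · exact Finset.sum_congr rfl fun f _ => by rw [card_extensions_eq st bl w₀ hst hbl f]
  · intro g _ hg
    rw [Finset.card_eq_zero.2, zero_smul]
    rw [Finset.filter_eq_empty_iff]
    rintro w - ⟨hw, hgw⟩
    refine hg (Finset.mem_image.2 ⟨g ∘ st, Finset.mem_univ _, (hconst g fun a ha => ?_).symm⟩)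
    rw [← hw a ha]
    exact congrFun hgw a

end Blocks

/-- The rotation of every block of `[n]`, `n = ∑ α_i`. -/
def blockRotation (α : List ℕ) : Equiv.Perm (Fin (∑ i : Fin α.length, α.get i)) :=
  finSigmaFinEquiv.permCongr (Equiv.sigmaCongrRight fun _ => finRotate _)

theorem blockRotation_apply (α : List ℕ) (a : Σ i : Fin α.length, Fin (α.get i)) :
    blockRotation α (finSigmaFinEquiv a) = finSigmaFinEquiv ⟨a.1, finRotate _ a.2⟩ := by
  simp [blockRotation, Equiv.permCongr_apply]

/-- The blocks are the paths, and `w₀` closes each path up to a cycle. Forgetting the arrows of `w₀`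
that end at a block start leaves exactly the arrows of the partial permutation. -/
theorem pathPartialPerm_atomic_apply (α : List ℕ) (hα : ∀ d ∈ α, 0 < d) (N : ℕ) :
    (pathPartialPerm α).atomic.1 N =
      ∑ f : Fin α.length → Fin N,
        (∏ k, (Finset.univ.filter fun i => f i = k).card.factorial) •
          ∏ i, (X (f i) : MvPolynomial (Fin N) ℂ) ^ α.get i := by
  classical
  have hpos : ∀ i : Fin α.length, 0 < α.get i := fun i => hα _ (α.get_mem i)
  let st : Fin α.length ↪ Fin (∑ i : Fin α.length, α.get i) :=
    ⟨fun i => finSigmaFinEquiv ⟨i, ⟨0, hpos i⟩⟩, fun i j h => by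
      have := finSigmaFinEquiv.injective h
      exact congrArg Sigma.fst this⟩
  let bl : Fin (∑ i : Fin α.length, α.get i) → Fin α.length := fun a =>
    (finSigmaFinEquiv.symm a).1
  have hbl' : ∀ a, bl (finSigmaFinEquiv a) = a.1 := fun a => by simp [bl]
  have hrot : ∀ (i : Fin α.length) (b : Fin (α.get i)),
      (b.1 + 1 < α.get i → (finRotate _ b).1 = b.1 + 1) ∧
        (b.1 + 1 = α.get i → (finRotate _ b).1 = 0) := by
    intro i
    generalize α.get i = d
    intro b
    cases d with
    | zero => exact b.elim0
    | succ d =>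
      rw [coe_finRotate]
      constructor
      · intro h
        rw [if_neg]
        intro h'
        rw [h', Fin.val_last] at h
        omega
      · intro h
        rw [if_pos]
        ext
        rw [Fin.val_last]
        omega
  -- The rotation reaches a block start only from the last vertex of a block, so the other vertices
  -- are the ones where the partial permutation is defined.
  have hrange : ∀ a : Σ i : Fin α.length, Fin (α.get i),
      blockRotation α (finSigmaFinEquiv a) ∉ Set.range st ↔ a.2.1 + 1 < α.get a.1 := by
    rintro ⟨i, b⟩
    rw [blockRotation_apply]
    constructor
    · intro h
      by_contra hlt
      refine h ⟨i, ?_⟩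
      have := (hrot i b).2 (by have := b.2; simp only at hlt; omega)
      change finSigmaFinEquiv _ = _
      congr 2
      ext
      exact this.symm
    · rintro h ⟨j, hj⟩
      have hj := finSigmaFinEquiv.injective hj
      have h2 := (hrot i b).1 h
      simp only [Sigma.mk.injEq] at hj
      obtain ⟨rfl, hj⟩ := hj
      rw [← eq_of_heq hj] at h2
      simp at h2
  have hind : ∀ w : Equiv.Perm (Fin (∑ i : Fin α.length, α.get i)),
      (∀ a, (blockRotation α) a ∉ Set.range st → w a = blockRotation α a) ↔
        ∀ a, w ((pathPartialPerm α).I a) = (pathPartialPerm α).J a := by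
    intro w
    constructor
    · rintro h ⟨i, b⟩
      have hb : b.1 + 1 < α.get i := by have := b.2; omega
      refine (h _ ((hrange ⟨i, ⟨b, by omega⟩⟩).2 hb)).trans ?_
      rw [blockRotation_apply]
      change finSigmaFinEquiv _ = finSigmaFinEquiv _
      congr 2
      ext
      exact (hrot i ⟨b, by omega⟩).1 hb
    · intro h a ha
      obtain ⟨⟨i, b⟩, rfl⟩ := finSigmaFinEquiv.surjective a
      have hb := (hrange ⟨i, b⟩).1 ha
      simp only at hb
      refine (h ⟨i, ⟨b, by omega⟩⟩).trans ?_
      rw [blockRotation_apply]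
      change finSigmaFinEquiv _ = finSigmaFinEquiv _
      congr 2
      ext
      exact ((hrot i b).1 hb).symm
  have key := sum_extensions_colorings (κ := Fin N) st bl (blockRotation α)
    (fun i => hbl' _) (fun a => by
      obtain ⟨a, rfl⟩ := finSigmaFinEquiv.surjective a
      rw [blockRotation_apply, hbl', hbl'])
    (fun g hg => by
      funext a
      obtain ⟨⟨i, ⟨b, hb⟩⟩, rfl⟩ := finSigmaFinEquiv.surjective a
      simp only [Function.comp, hbl']
      induction b with
      | zero => rfl
      | succ b ih =>
        rw [← ih (by omega)]
        have := hg (finSigmaFinEquiv ⟨i, ⟨b, by omega⟩⟩) ((hrange _).2 hb)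
        rw [← this, blockRotation_apply]
        congr 3
        ext
        exact ((hrot i ⟨b, by omega⟩).1 hb).symm)
    (fun g => ∏ a, (X (g a) : MvPolynomial (Fin N) ℂ))
  rw [PartialPerm.atomic_eq_sum]
  have h1 : (∑ w, (pathPartialPerm α).indicator w • powerSum w.partition : SymFun).1 N =
      ∑ w, (pathPartialPerm α).indicator w • (powerSum w.partition).1 N := by
    rw [AddSubmonoidClass.coe_finsetSum, Finset.sum_apply]
    rfl
  rw [h1]
  simp only [PartialPerm.indicator, ite_smul, one_smul, zero_smul, powerSum_partition_apply]
  rw [← Finset.sum_filter]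
  simp only [← hind]
  refine Eq.trans ?_ (key.trans ?_)
  · exact Finset.sum_congr (by congr) fun w _ => Finset.sum_congr (by congr) fun g _ => rfl
  · refine Finset.sum_congr rfl fun f _ => ?_
    congr 1
    rw [← Equiv.prod_comp finSigmaFinEquiv, Fintype.prod_sigma]
    refine Finset.prod_congr rfl fun i _ => ?_
    simp only [Function.comp, hbl']
    rw [Finset.prod_const, Finset.card_univ, Fintype.card_fin]

/-! ### Products with alternants -/

theorem alternant_comp_perm {N : ℕ} (β : Fin N → ℕ) (w : Equiv.Perm (Fin N)) :
    alternant (β ∘ w) = (Equiv.Perm.sign w : ℤ) • alternant β := by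
  have h := Matrix.det_permute' w (Matrix.of fun i j => (X i : MvPolynomial (Fin N) ℂ) ^ β j)
  rw [alternant_eq_det, alternant_eq_det, zsmul_eq_mul, ← h]
  rfl

/-- Multiplying an alternant by a symmetric sum of monomials adds up exponent vectors. -/
theorem alternant_mul_of_isSymmetric {N : ℕ} {Φ : Type*} [Fintype Φ] (c : Φ → ℕ)
    (e : Φ → Fin N → ℕ) (β : Fin N → ℕ) (P : MvPolynomial (Fin N) ℂ)
    (hP : P = ∑ f, c f • ∏ j, X j ^ e f j) (hs : P.IsSymmetric) :
    alternant β * P = ∑ f, c f • alternant (β + e f) := by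
  simp only [alternant, Finset.smul_sum, Finset.sum_mul]
  rw [Finset.sum_comm]
  refine Finset.sum_congr rfl fun w _ => ?_
  -- Symmetry lets `P` be replaced by its image under `w`, so that the monomials of `P` are renamed
  -- together with the monomial of the alternant.
  conv_lhs => rw [← hs w, smul_mul_assoc, ← map_mul, hP, Finset.mul_sum, map_sum, Finset.smul_sum]
  refine Finset.sum_congr rfl fun f _ => ?_
  rw [mul_smul_comm, map_nsmul, smul_comm]
  simp only [← Finset.prod_mul_distrib, ← pow_add, Pi.add_apply]

/-! ### Distributing letters to variables -/

section Transfer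

variable {ι : Type} [Fintype ι] [DecidableEq ι] {N : ℕ}

/-- The distributions of the letters in `S` to the variables in `U`; letters outside of `S` are
sent to `0`. -/
def distributions (S : Finset ι) (U : Finset (Fin (N + 1))) : Finset (ι → Fin (N + 1)) :=
  Fintype.piFinset fun j => if j ∈ S then U else {0}

/-- The number of ways to order the letters received by each variable. -/
def orderings (S : Finset ι) (f : ι → Fin (N + 1)) : ℕ :=
  ∏ x, (S.filter fun j => f j = x).card.factorial

/-- The total weight received by each variable. -/
def received (a : ι → ℕ) (S : Finset ι) (f : ι → Fin (N + 1)) (x : Fin (N + 1)) : ℕ :=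
  ∑ j ∈ S with f j = x, a j

/-- The sum of `ε · x^{β + ⋯}` over all ways to write the letters in `S` as words attached to
the variables in `U`. -/
def transfer (a : ι → ℕ) (β : Fin (N + 1) → ℕ) (S : Finset ι) (U : Finset (Fin (N + 1))) :
    MvPolynomial (Fin (N + 1)) ℂ :=
  ∑ f ∈ distributions S U, orderings S f • alternant (β + received a S f)

theorem mem_distributions {S : Finset ι} {U : Finset (Fin (N + 1))} {f : ι → Fin (N + 1)} :
    f ∈ distributions S U ↔ (∀ j ∈ S, f j ∈ U) ∧ ∀ j ∉ S, f j = 0 := by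
  rw [distributions, Fintype.mem_piFinset]
  constructor
  · intro h
    refine ⟨fun j hj => ?_, fun j hj => ?_⟩
    · simpa [hj] using h j
    · simpa [hj] using h j
  · rintro ⟨h1, h2⟩ j
    by_cases hj : j ∈ S
    · simpa [hj] using h1 j hj
    · simpa [hj] using h2 j hj

theorem alternant_mul_path (α : List ℕ) (hα : ∀ d ∈ α, 0 < d) (N : ℕ)
    (β : Fin (N + 1) → ℕ) :
    alternant β * (pathPartialPerm α).atomic.1 (N + 1) =
      transfer α.get β Finset.univ Finset.univ := by
  rw [alternant_mul_of_isSymmetric (fun f : Fin α.length → Fin (N + 1) => orderings Finset.univ f)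
    (fun f => received α.get Finset.univ f) β _ _ ((pathPartialPerm α).atomic.2.1 (N + 1))]
  · rw [transfer]
    refine Finset.sum_congr ?_ fun _ _ => rfl
    ext f
    simp [mem_distributions]
  · rw [pathPartialPerm_atomic_apply α hα]
    refine Finset.sum_congr rfl fun f _ => ?_
    rw [orderings, ← Finset.prod_fiberwise Finset.univ f]
    congr 1
    refine Finset.prod_congr rfl fun x _ => ?_
    rw [received, ← Finset.prod_pow_eq_pow_sum]
    refine Finset.prod_congr rfl fun j hj => ?_
    rw [(Finset.mem_filter.1 hj).2]

/-- Since `w` preserves `U`, composing distributions with `w` permutes them; what is left is the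
sign by which each alternant changes. -/
theorem transfer_comp_perm (a : ι → ℕ) (β : Fin (N + 1) → ℕ) (S : Finset ι)
    (U : Finset (Fin (N + 1))) (w : Equiv.Perm (Fin (N + 1))) (hw : ∀ x, w x ∈ U ↔ x ∈ U) :
    transfer a (β ∘ w) S U = (Equiv.Perm.sign w : ℤ) • transfer a β S U := by
  rw [transfer, transfer, Finset.smul_sum]
  refine Finset.sum_bij' (fun f _ j => if j ∈ S then w (f j) else 0)
    (fun f _ j => if j ∈ S then w⁻¹ (f j) else 0) ?_ ?_ ?_ ?_ ?_
  · intro f hf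
    rw [mem_distributions] at hf ⊢
    refine ⟨fun j hj => ?_, fun j hj => if_neg hj⟩
    simp only [if_pos hj]
    exact (hw _).2 (hf.1 j hj)
  · intro f hf
    rw [mem_distributions] at hf ⊢
    refine ⟨fun j hj => ?_, fun j hj => if_neg hj⟩
    simp only [if_pos hj]
    rw [← hw]
    simpa using hf.1 j hj
  · intro f hf
    rw [mem_distributions] at hf
    funext j
    by_cases hj : j ∈ S
    · simp [hj]
    · simp [hj, hf.2 j hj]
  · intro f hf
    rw [mem_distributions] at hf
    funext j
    by_cases hj : j ∈ S
    · simp [hj]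
    · simp [hj, hf.2 j hj]
  · intro f hf
    have hfil : ∀ x, (S.filter fun j => (if j ∈ S then w (f j) else 0) = w x) =
        S.filter fun j => f j = x := by
      intro x
      refine Finset.filter_congr fun j hj => ?_
      rw [if_pos hj, w.injective.eq_iff]
    have h1 : orderings S (fun j => if j ∈ S then w (f j) else 0) = orderings S f := by
      rw [orderings, orderings, ← Equiv.prod_comp w]
      exact Finset.prod_congr rfl fun x _ => by rw [hfil]
    have h2 : β ∘ w + received a S f =
        (β + received a S fun j => if j ∈ S then w (f j) else 0) ∘ w := by
      funext x
      simp only [Pi.add_apply, Function.comp, received, hfil]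
    rw [h1, h2, alternant_comp_perm, smul_comm]

theorem transfer_eq_zero (a : ι → ℕ) {β : Fin (N + 1) → ℕ} (S : Finset ι)
    {U : Finset (Fin (N + 1))} {i j : Fin (N + 1)} (hij : i ≠ j) (hi : i ∈ U) (hj : j ∈ U)
    (h : β i = β j) : transfer a β S U = 0 := by
  have h1 := transfer_comp_perm a β S U (Equiv.swap i j) (fun x => by
    rcases eq_or_ne x i with rfl | hxi
    · simp [hi, hj]
    rcases eq_or_ne x j with rfl | hxj
    · simp [hi, hj]
    rw [Equiv.swap_apply_of_ne_of_ne hxi hxj])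
  have h2 : β ∘ Equiv.swap i j = β := by
    funext x
    rcases eq_or_ne x i with rfl | hxi
    · simp [h]
    rcases eq_or_ne x j with rfl | hxj
    · simp [h]
    simp [Equiv.swap_apply_of_ne_of_ne hxi hxj]
  rw [h2, Equiv.Perm.sign_swap hij] at h1
  simpa [self_eq_neg] using h1

/-- Either no letter goes to `i`, or the word at `i` has a distinguished end letter `s`. Removing
`s` leaves an arbitrary distribution of the other letters to the same `U`, with its size recorded in
the exponent of `i`. -/
theorem transfer_erase (a : ι → ℕ) (β : Fin (N + 1) → ℕ) (S : Finset ι)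
    {U : Finset (Fin (N + 1))} {i : Fin (N + 1)} (hi : i ∈ U) :
    transfer a β S U = transfer a β S (U.erase i) +
      ∑ s ∈ S, transfer a (β + Pi.single i (a s)) (S.erase s) U := by
  rw [transfer, ← Finset.sum_filter_add_sum_filter_not _ fun f => ∀ j ∈ S, f j ≠ i]
  congr 1
  · refine Finset.sum_congr ?_ fun _ _ => rfl
    ext f
    rw [Finset.mem_filter, mem_distributions, mem_distributions]
    simp only [Finset.mem_erase]
    constructor
    · rintro ⟨⟨h1, h2⟩, h3⟩
      exact ⟨fun j hj => ⟨h3 j hj, h1 j hj⟩, h2⟩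
    · rintro ⟨h1, h2⟩
      exact ⟨⟨fun j hj => (h1 j hj).2, h2⟩, fun j hj => (h1 j hj).1⟩
  · have hfil : ∀ (f : ι → Fin (N + 1)) (s : ι) (x : Fin (N + 1)),
        ((S.erase s).filter fun j => Function.update f s 0 j = x) =
          (S.filter fun j => f j = x).erase s := by
      intro f s x
      ext j
      simp only [Finset.mem_filter, Finset.mem_erase]
      constructor
      · rintro ⟨⟨h1, h2⟩, h3⟩
        rw [Function.update_of_ne h1] at h3
        exact ⟨h1, h2, h3⟩
      · rintro ⟨h1, h2, h3⟩
        rw [Function.update_of_ne h1]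
        exact ⟨⟨h1, h2⟩, h3⟩
    -- This is `k! = k * (k - 1)!` for the `k` letters at `i`, with the factor `k` read as the
    -- choice of `s`.
    have hord : ∀ f : ι → Fin (N + 1), (¬ ∀ j ∈ S, f j ≠ i) → orderings S f =
        ∑ s ∈ S with f s = i, orderings (S.erase s) (Function.update f s 0) := by
      intro f hf
      push Not at hf
      obtain ⟨s₀, hs₀, hfs₀⟩ := hf
      have h1 : ∀ s ∈ S.filter (fun s => f s = i),
          orderings (S.erase s) (Function.update f s 0) =
            ((S.filter fun j => f j = i).card - 1).factorial *
              ∏ x ∈ Finset.univ.erase i, (S.filter fun j => f j = x).card.factorial := by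
        intro s hs
        rw [orderings, ← Finset.mul_prod_erase _ _ (Finset.mem_univ i), hfil,
          Finset.card_erase_of_mem hs]
        congr 1
        refine Finset.prod_congr rfl fun x hx => ?_
        rw [hfil, Finset.erase_eq_of_notMem]
        intro h
        exact (Finset.mem_erase.1 hx).1
          ((Finset.mem_filter.1 h).2.symm.trans (Finset.mem_filter.1 hs).2)
      rw [Finset.sum_congr rfl h1, Finset.sum_const, smul_eq_mul, ← mul_assoc,
        Nat.mul_factorial_pred (Finset.card_ne_zero_of_mem (Finset.mem_filter.2 ⟨hs₀, hfs₀⟩)),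
        orderings, ← Finset.mul_prod_erase _ _ (Finset.mem_univ i)]
    have hrec : ∀ (f : ι → Fin (N + 1)), ∀ s ∈ S.filter (fun s => f s = i),
        received a S f = Pi.single i (a s) + received a (S.erase s) (Function.update f s 0) := by
      intro f s hs
      funext x
      simp only [Pi.add_apply, received, hfil]
      rcases eq_or_ne x i with rfl | hx
      · rw [Pi.single_eq_same, Finset.add_sum_erase _ _ hs]
      · rw [Pi.single_eq_of_ne hx, zero_add, Finset.erase_eq_of_notMem]
        intro h
        exact hx ((Finset.mem_filter.1 h).2.symm.trans (Finset.mem_filter.1 hs).2)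
    have h1 : ∀ f ∈ (distributions S U).filter (fun f => ¬ ∀ j ∈ S, f j ≠ i),
        orderings S f • alternant (β + received a S f) =
          ∑ s ∈ S with f s = i, orderings (S.erase s) (Function.update f s 0) •
            alternant (β + Pi.single i (a s) +
              received a (S.erase s) (Function.update f s 0)) := by
      intro f hf
      rw [hord f (Finset.mem_filter.1 hf).2, Finset.sum_smul]
      refine Finset.sum_congr rfl fun s hs => ?_
      rw [hrec f s hs, add_assoc]
    rw [Finset.sum_congr rfl h1]
    simp only [transfer]
    rw [Finset.sum_sigma', Finset.sum_sigma']
    -- Distributions take the value `0` off their set of letters, so the erased letter is reset to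
    -- `0` and, in the other direction, put back at `i`.
    refine Finset.sum_bij' (fun p _ => ⟨p.2, Function.update p.1 p.2 0⟩)
      (fun p _ => ⟨Function.update p.2 p.1 i, p.1⟩) ?_ ?_ ?_ ?_ ?_
    · rintro ⟨f, s⟩ hp
      simp only [Finset.mem_sigma, Finset.mem_filter, mem_distributions] at hp ⊢
      obtain ⟨⟨⟨h1, h2⟩, -⟩, hs, -⟩ := hp
      refine ⟨hs, fun j hj => ?_, fun j hj => ?_⟩
      · rw [Finset.mem_erase] at hj
        rw [Function.update_of_ne hj.1]
        exact h1 j hj.2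
      · rcases eq_or_ne j s with rfl | hjs
        · simp
        · rw [Function.update_of_ne hjs]
          exact h2 j fun h => hj (Finset.mem_erase.2 ⟨hjs, h⟩)
    · rintro ⟨s, f⟩ hp
      simp only [Finset.mem_sigma, Finset.mem_filter, mem_distributions] at hp ⊢
      obtain ⟨hs, h1, h2⟩ := hp
      refine ⟨⟨⟨fun j hj => ?_, fun j hj => ?_⟩, ?_⟩, hs, by simp⟩
      · rcases eq_or_ne j s with rfl | hjs
        · simpa using hi
        · rw [Function.update_of_ne hjs]
          exact h1 j (Finset.mem_erase.2 ⟨hjs, hj⟩)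
      · rcases eq_or_ne j s with rfl | hjs
        · exact absurd hs hj
        · rw [Function.update_of_ne hjs]
          exact h2 j fun h => hj (Finset.mem_of_mem_erase h)
      · exact fun h => h s hs (by simp)
    · rintro ⟨f, s⟩ hp
      simp only [Finset.mem_sigma, Finset.mem_filter] at hp
      simp [← hp.2.2]
    · rintro ⟨s, f⟩ hp
      simp only [Finset.mem_sigma, mem_distributions] at hp
      have := hp.2.2 s (Finset.notMem_erase s S)
      simp [← this]
    · rintro ⟨f, s⟩ hp
      rfl

theorem transfer_singleton_zero (a : ι → ℕ) (β : Fin (N + 1) → ℕ) (S : Finset ι) :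
    transfer a β S {0} = S.card.factorial • alternant (β + Pi.single 0 (∑ s ∈ S, a s)) := by
  have h : distributions (N := N) S {0} = {fun _ => 0} := by
    ext f
    rw [mem_distributions, Finset.mem_singleton, funext_iff]
    simp only [Finset.mem_singleton]
    refine ⟨fun h j => ?_, fun h => ⟨fun j _ => h j, fun j _ => h j⟩⟩
    by_cases hj : j ∈ S
    · exact h.1 j hj
    · exact h.2 j hj
  rw [transfer, h, Finset.sum_singleton]
  congr 1
  · rw [orderings, Finset.prod_eq_single 0]
    · simp
    · intro x _ hx
      simp [hx.symm]
    · simp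
  · congr 2
    funext x
    rcases eq_or_ne x 0 with rfl | hx
    · simp [received]
    · simp [received, hx, hx.symm]

/-- Conditioning on the variable with the largest index that receives a letter. -/
theorem transfer_Iic (a : ι → ℕ) (β : Fin (N + 1) → ℕ) (S : Finset ι) (r : Fin (N + 1)) :
    transfer a β S (Finset.Iic r) =
      S.card.factorial • alternant (β + Pi.single 0 (∑ s ∈ S, a s)) +
        ∑ i ∈ Finset.Ioc 0 r, ∑ s ∈ S,
          transfer a (β + Pi.single i (a s)) (S.erase s) (Finset.Iic i) := by
  induction r using Fin.induction with
  | zero =>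
    rw [Finset.Ioc_self, Finset.sum_empty, add_zero, ← transfer_singleton_zero]
    congr 1
  | succ r ih =>
    have h1 : (Finset.Iic r.succ).erase r.succ = Finset.Iic r.castSucc := by
      ext x
      simp only [Finset.mem_erase, Finset.mem_Iic, Fin.le_def, ne_eq, Fin.ext_iff, Fin.val_succ,
        Fin.val_castSucc]
      omega
    have h2 : Finset.Ioc 0 r.succ = insert r.succ (Finset.Ioc 0 r.castSucc) := by
      ext x
      simp only [Finset.mem_insert, Finset.mem_Ioc, Fin.le_def, Fin.lt_def, Fin.ext_iff,
        Fin.val_succ, Fin.val_castSucc, Fin.val_zero]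
      omega
    rw [transfer_erase a β S (Finset.mem_Iic.2 le_rfl), h1, ih, h2, Finset.sum_insert, ← add_assoc,
      add_right_comm]
    simp [Fin.le_def]

end Transfer

/-! ### Ribbons in terms of row lengths -/

/-- `lam` is obtained from `nu` by adding a ribbon that occupies the rows from `p` to `i`. -/
structure RibbonStep (nu lam : YoungDiagram) (p i : ℕ) : Prop where
  le : p ≤ i
  rowLen_eq : ∀ j, j < p ∨ i < j → lam.rowLen j = nu.rowLen j
  rowLen_succ : ∀ j, p ≤ j → j < i → lam.rowLen (j + 1) = nu.rowLen j + 1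
  rowLen_lt : nu.rowLen p < lam.rowLen p

theorem mem_cells_sdiff {nu lam : YoungDiagram} {j c : ℕ} :
    (j, c) ∈ lam.cells \ nu.cells ↔ nu.rowLen j ≤ c ∧ c < lam.rowLen j := by
  rw [Finset.mem_sdiff, YoungDiagram.mem_cells, YoungDiagram.mem_cells,
    YoungDiagram.mem_iff_lt_rowLen, YoungDiagram.mem_iff_lt_rowLen, not_lt, and_comm]

theorem le_iff_rowLen_le {nu lam : YoungDiagram} :
    nu ≤ lam ↔ ∀ j, nu.rowLen j ≤ lam.rowLen j := by
  constructor
  · intro h j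
    by_contra hlt
    have h1 : (j, lam.rowLen j) ∈ nu := YoungDiagram.mem_iff_lt_rowLen.2 (not_le.1 hlt)
    exact lt_irrefl _ (YoungDiagram.mem_iff_lt_rowLen.1 (h h1))
  · rintro h ⟨j, c⟩ hc
    exact YoungDiagram.mem_iff_lt_rowLen.2 ((YoungDiagram.mem_iff_lt_rowLen.1 hc).trans_le (h j))

namespace RibbonStep

variable {nu lam : YoungDiagram} {p i : ℕ}

theorem rowLen_lt_of_mem (h : RibbonStep nu lam p i) {j : ℕ} (hp : p ≤ j) (hi : j ≤ i) :
    nu.rowLen j < lam.rowLen j := by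
  rcases hp.eq_or_lt with rfl | hp
  · exact h.rowLen_lt
  · obtain ⟨k, rfl⟩ : ∃ k, j = k + 1 := ⟨j - 1, by omega⟩
    rw [h.rowLen_succ k (by omega) (by omega)]
    exact Nat.lt_succ_of_le (nu.rowLen_anti _ _ (Nat.le_succ k))

theorem diagram_le (h : RibbonStep nu lam p i) : nu ≤ lam := by
  rw [le_iff_rowLen_le]
  intro j
  by_cases hj : p ≤ j ∧ j ≤ i
  · exact (h.rowLen_lt_of_mem hj.1 hj.2).le
  · exact (h.rowLen_eq j (by omega)).ge

theorem mem_iff (h : RibbonStep nu lam p i) {j c : ℕ} : (j, c) ∈ lam.cells \ nu.cells ↔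
    p ≤ j ∧ j ≤ i ∧ nu.rowLen j ≤ c ∧ c < lam.rowLen j := by
  rw [mem_cells_sdiff]
  constructor
  · rintro ⟨h1, h2⟩
    by_cases hj : p ≤ j ∧ j ≤ i
    · exact ⟨hj.1, hj.2, h1, h2⟩
    · have := h.rowLen_eq j (by omega)
      omega
  · rintro ⟨-, -, h1, h2⟩
    exact ⟨h1, h2⟩

theorem image_fst (h : RibbonStep nu lam p i) :
    (lam.cells \ nu.cells).image Prod.fst = Finset.Icc p i := by
  ext j
  rw [Finset.mem_image, Finset.mem_Icc]
  constructor
  · rintro ⟨⟨j, c⟩, hc, rfl⟩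
    exact ⟨(h.mem_iff.1 hc).1, (h.mem_iff.1 hc).2.1⟩
  · rintro ⟨h1, h2⟩
    exact ⟨(j, nu.rowLen j), h.mem_iff.2 ⟨h1, h2, le_rfl, h.rowLen_lt_of_mem h1 h2⟩, rfl⟩

theorem height_eq (h : RibbonStep nu lam p i) : height (lam.cells \ nu.cells) = i - p := by
  rw [height, h.image_fst, Nat.card_Icc]
  omega

theorem tailRow_eq (h : RibbonStep nu lam p i) : tailRow (lam.cells \ nu.cells) = i := by
  refine le_antisymm (Finset.sup_le ?_) ?_
  · rintro ⟨j, c⟩ hc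
    exact (h.mem_iff.1 hc).2.1
  · exact Finset.le_sup (f := Prod.fst) (b := (i, nu.rowLen i))
      (h.mem_iff.2 ⟨h.le, le_rfl, le_rfl, h.rowLen_lt_of_mem h.le le_rfl⟩)

theorem tailCol_eq (h : RibbonStep nu lam p i) :
    tailCol (lam.cells \ nu.cells) = nu.rowLen i := by
  rw [tailCol, h.tailRow_eq]
  refine le_antisymm (Nat.sInf_le ?_) (le_csInf ⟨nu.rowLen i, ?_⟩ ?_)
  · exact h.mem_iff.2 ⟨h.le, le_rfl, le_rfl, h.rowLen_lt_of_mem h.le le_rfl⟩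
  · exact h.mem_iff.2 ⟨h.le, le_rfl, le_rfl, h.rowLen_lt_of_mem h.le le_rfl⟩
  · intro c hc
    exact (h.mem_iff.1 hc).2.2.1

/-- The row lengths telescope, because each row of the ribbon below the top one ends one column past
the old end of the row above. In terms of the beads `rowLen j - j`, the bead of row `i` moves up by
the size of the ribbon and becomes the bead of row `p`. -/
theorem card_add (h : RibbonStep nu lam p i) :
    (lam.cells \ nu.cells).card + nu.rowLen i = lam.rowLen p + (i - p) := by
  have h1 : (lam.cells \ nu.cells).card = ∑ j ∈ Finset.Icc p i, (lam.rowLen j - nu.rowLen j) := by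
    rw [← h.image_fst, Finset.card_eq_sum_card_image Prod.fst]
    refine Finset.sum_congr rfl fun j hj => ?_
    rw [h.image_fst, Finset.mem_Icc] at hj
    rw [← Nat.card_Ico, ← Finset.card_map (Function.Embedding.sectR j ℕ)]
    congr 1
    ext ⟨j', c⟩
    simp only [Finset.mem_filter, h.mem_iff, Finset.mem_map, Finset.mem_Ico,
      Function.Embedding.sectR_apply, Prod.mk.injEq]
    constructor
    · rintro ⟨⟨-, -, h1, h2⟩, rfl⟩
      exact ⟨c, ⟨h1, h2⟩, rfl, rfl⟩
    · rintro ⟨c', ⟨h1, h2⟩, rfl, rfl⟩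
      exact ⟨⟨hj.1, hj.2, h1, h2⟩, rfl⟩
  have h2 : ∀ k, p + k ≤ i → ∑ j ∈ Finset.Icc p (p + k), (lam.rowLen j - nu.rowLen j) +
      nu.rowLen (p + k) = lam.rowLen p + k := by
    intro k
    induction k with
    | zero =>
      intro _
      have := h.rowLen_lt
      simp only [add_zero, Finset.Icc_self, Finset.sum_singleton]
      omega
    | succ k ih =>
      intro hk
      have h3 := ih (by omega)
      have h4 := h.rowLen_succ (p + k) (by omega) (by omega)
      have h5 := nu.rowLen_anti _ _ (Nat.le_succ (p + k))
      rw [← add_assoc, Finset.sum_Icc_succ_top (by omega), h4]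
      simp only [Nat.succ_eq_add_one] at h5
      omega
  have h3 := h2 (i - p) (by have := h.le; omega)
  rw [Nat.add_sub_cancel' h.le] at h3
  rw [h1, h3]

theorem cells_eq_union (h : RibbonStep nu lam p i) :
    lam.cells = nu.cells ∪ (lam.cells \ nu.cells) :=
  (Finset.union_sdiff_of_subset h.diagram_le).symm

theorem card_eq (h : RibbonStep nu lam p i) :
    lam.card = nu.card + (lam.cells \ nu.cells).card := by
  have h1 : nu.cells ⊆ lam.cells := h.diagram_le
  have h2 := Finset.card_sdiff_add_card_eq_card h1
  change lam.cells.card = nu.cells.card + _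
  omega

theorem isRibbon (h : RibbonStep nu lam p i) : IsRibbon (lam.cells \ nu.cells) := by
  refine ⟨⟨lam, nu, h.diagram_le, rfl⟩, ?_, ?_⟩
  · set ξ := lam.cells \ nu.cells with hξ
    have htail : (i, nu.rowLen i) ∈ ξ :=
      h.mem_iff.2 ⟨h.le, le_rfl, le_rfl, h.rowLen_lt_of_mem h.le le_rfl⟩
    let G := (SimpleGraph.hasse (ℕ × ℕ)).induce (ξ : Set (ℕ × ℕ))
    have hrow : ∀ k j, ∀ hm : (j, nu.rowLen j + k) ∈ ξ, ∀ hm' : (j, nu.rowLen j) ∈ ξ,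
        G.Reachable ⟨_, hm⟩ ⟨_, hm'⟩ := by
      intro k
      induction k with
      | zero => intro j hm hm'; rfl
      | succ k ih =>
        intro j hm hm'
        have h1 := h.mem_iff.1 hm
        have h2 : (j, nu.rowLen j + k) ∈ ξ := h.mem_iff.2 ⟨h1.1, h1.2.1, by omega, by omega⟩
        refine SimpleGraph.Reachable.trans (SimpleGraph.Adj.reachable ?_) (ih j h2 hm')
        refine Or.inr ?_
        exact Prod.mk_covBy_mk_iff.2 (Or.inr ⟨Order.covBy_add_one _, rfl⟩)
    have hcol : ∀ k j, j + k = i → ∀ hm : (j, nu.rowLen j) ∈ ξ,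
        G.Reachable ⟨_, hm⟩ ⟨_, htail⟩ := by
      intro k
      induction k with
      | zero =>
        rintro j rfl hm
        rfl
      | succ k ih =>
        intro j hj hm
        have h1 := h.mem_iff.1 hm
        have h2 := h.rowLen_succ j h1.1 (by omega)
        have h3 := nu.rowLen_anti _ _ (Nat.le_succ j)
        have h4 : (j + 1, nu.rowLen (j + 1)) ∈ ξ :=
          h.mem_iff.2 ⟨by omega, by omega, le_rfl, h.rowLen_lt_of_mem (by omega) (by omega)⟩
        have h5 : (j + 1, nu.rowLen j) ∈ ξ := h.mem_iff.2 ⟨by omega, by omega, h3, by omega⟩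
        have h6 := hrow (nu.rowLen j - nu.rowLen (j + 1)) (j + 1)
          (by rwa [Nat.add_sub_cancel' h3]) h4
        simp only [Nat.add_sub_cancel' h3] at h6
        refine SimpleGraph.Reachable.trans (SimpleGraph.Adj.reachable (v := ⟨_, h5⟩) ?_)
          (h6.trans (ih (j + 1) (by omega) h4))
        refine Or.inl ?_
        exact Prod.mk_covBy_mk_iff.2 (Or.inl ⟨Order.covBy_add_one _, rfl⟩)
    rw [SimpleGraph.connected_iff_exists_forall_reachable]
    refine ⟨⟨_, htail⟩, ?_⟩
    rintro ⟨⟨j, c⟩, hc⟩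
    have h1 := h.mem_iff.1 hc
    have h2 : (j, nu.rowLen j) ∈ ξ :=
      h.mem_iff.2 ⟨h1.1, h1.2.1, le_rfl, h.rowLen_lt_of_mem h1.1 h1.2.1⟩
    have h3 := hrow (c - nu.rowLen j) j (by rwa [Nat.add_sub_cancel' h1.2.2.1]) h2
    simp only [Nat.add_sub_cancel' h1.2.2.1] at h3
    exact (h3.trans (hcol (i - j) j (by omega) h2)).symm
  · rintro j c ⟨h1, -, -, h4⟩
    have h1 := h.mem_iff.1 h1
    have h4 := h.mem_iff.1 h4
    have := h.rowLen_succ j h1.1 (by omega)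
    omega

/-- The next ribbon has its tail strictly to the right exactly if it has its tail weakly above. -/
theorem tail_lt_iff (h : RibbonStep nu lam p i) (j : ℕ) :
    nu.rowLen i < lam.rowLen j ↔ j ≤ i := by
  constructor
  · intro h1
    by_contra hj
    rw [h.rowLen_eq j (by omega)] at h1
    have := nu.rowLen_anti i j (by omega)
    omega
  · intro hj
    exact (h.rowLen_lt_of_mem h.le le_rfl).trans_le (lam.rowLen_anti _ _ hj)

end RibbonStep

/-- A ribbon that is the difference of two Young diagrams comes from a ribbon step. -/
theorem exists_ribbonStep {nu lam : YoungDiagram} (hle : nu ≤ lam)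
    (hr : IsRibbon (lam.cells \ nu.cells)) : ∃ p i, RibbonStep nu lam p i := by
  obtain ⟨-, hconn, hsq⟩ := hr
  set ξ := lam.cells \ nu.cells with hξ
  have hne : ξ.Nonempty := by
    obtain ⟨⟨x, hx⟩⟩ := hconn.nonempty
    exact ⟨x, hx⟩
  obtain ⟨⟨p, a⟩, hp, hpmin⟩ := Finset.exists_min_image ξ Prod.fst hne
  obtain ⟨⟨i, b⟩, hi, himax⟩ := Finset.exists_max_image ξ Prod.fst hne
  have hrows := le_iff_rowLen_le.1 hle
  have hrow_mem : ∀ j, nu.rowLen j < lam.rowLen j → p ≤ j ∧ j ≤ i := fun j hj =>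
    ⟨hpmin (j, nu.rowLen j) (mem_cells_sdiff.2 ⟨le_rfl, hj⟩),
      himax (j, nu.rowLen j) (mem_cells_sdiff.2 ⟨le_rfl, hj⟩)⟩
  refine ⟨p, i, hpmin _ hi, fun j hj => ?_, fun j hpj hji => ?_, ?_⟩
  · have := hrow_mem j
    have := hrows j
    omega
  · refine le_antisymm ?_ ?_
    · by_contra hlt
      -- If row `j + 1` of `lam` were longer, there would be a `2 × 2` square with upper left box
      -- `(j, nu.rowLen j)`.
      have h1 := nu.rowLen_anti _ _ (Nat.le_succ j)
      have h2 := lam.rowLen_anti _ _ (Nat.le_succ j)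
      simp only [Nat.succ_eq_add_one] at h1 h2
      refine hsq j (nu.rowLen j) ⟨?_, ?_, ?_, ?_⟩ <;> rw [hξ, mem_cells_sdiff] <;> omega
    -- A walk from the top row to the bottom row has to leave the rows `≤ j`. It does so by a
    -- vertical step within one column, and the row lengths bound this column from both sides.
    · obtain ⟨w⟩ := hconn.preconnected ⟨_, hp⟩ ⟨_, hi⟩
      obtain ⟨d, -, hd1, hd2⟩ := w.exists_boundary_dart {x | x.1.1 ≤ j} hpj (by simpa using hji)
      obtain ⟨⟨⟨⟨x1, x2⟩, hx⟩, ⟨⟨y1, y2⟩, hy⟩⟩, hadj⟩ := d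
      simp only [Set.mem_ofPred_eq, not_le] at hd1 hd2
      have hx := mem_cells_sdiff.1 hx
      have hy := mem_cells_sdiff.1 hy
      have hxy : x2 = y2 ∧ x1 = j := by
        rcases hadj with h | h
        · rcases Prod.mk_covBy_mk_iff.1 h with ⟨h1, h2⟩ | ⟨h1, h2⟩
          · rw [Nat.covBy_iff_add_one_eq] at h1
            exact ⟨h2, by omega⟩
          · omega
        · rcases Prod.mk_covBy_mk_iff.1 h with ⟨h1, h2⟩ | ⟨h1, h2⟩
          · rw [Nat.covBy_iff_add_one_eq] at h1
            omega
          · omega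
      obtain ⟨rfl, rfl⟩ := hxy
      have h1 := lam.rowLen_anti (x1 + 1) y1 (by omega)
      omega
  · have := mem_cells_sdiff.1 hp
    omega

/-- The Young diagram with given row lengths. -/
def ofRowLen (f : ℕ → ℕ) (hf : Antitone f) (K : ℕ) : YoungDiagram where
  cells := (Finset.range K ×ˢ Finset.range (f 0)).filter fun x => x.2 < f x.1
  isLowerSet := by
    rintro ⟨j, c⟩ ⟨j', c'⟩ ⟨hj, hc⟩ h
    simp only [Finset.coe_filter, Finset.mem_product, Finset.mem_range, Set.mem_ofPred_eq] at h ⊢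
    simp only at hj hc
    have := hf hj
    exact ⟨⟨by omega, by omega⟩, by omega⟩

theorem rowLen_ofRowLen (f : ℕ → ℕ) (hf : Antitone f) (K : ℕ) (hK : ∀ j, K ≤ j → f j = 0) (j : ℕ) :
    (ofRowLen f hf K).rowLen j = f j := by
  refine eq_of_forall_lt_iff fun c => ?_
  rw [← YoungDiagram.mem_iff_lt_rowLen, ← YoungDiagram.mem_cells]
  simp only [ofRowLen, Finset.mem_filter, Finset.mem_product, Finset.mem_range]
  constructor
  · exact fun h => h.2
  · intro h
    refine ⟨⟨?_, h.trans_le (hf j.zero_le)⟩, h⟩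
    by_contra hj
    rw [hK j (not_lt.1 hj)] at h
    omega

theorem rowLen_eq_zero {nu : YoungDiagram} {j : ℕ} (h : nu.colLen 0 ≤ j) : nu.rowLen j = 0 := by
  by_contra h0
  have h1 : (j, 0) ∈ nu := YoungDiagram.mem_iff_lt_rowLen.2 (Nat.pos_of_ne_zero h0)
  exact absurd (YoungDiagram.mem_iff_lt_colLen.1 h1) (not_lt.2 h)

/-- A ribbon of size `v` with its tail in row `i` can be added unless two beads collide. -/
theorem exists_ribbonStep_of_size (nu : YoungDiagram) (i v : ℕ) (hv : 0 < v)
    (h : ∀ j < i, nu.rowLen i + v + j ≠ nu.rowLen j + i) :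
    ∃ lam p, RibbonStep nu lam p i ∧ (lam.cells \ nu.cells).card = v := by
  -- Row `p` is the first one whose bead `nu.rowLen j - j` lies below the moved bead `nu.rowLen i +
  -- v - i`; the inequality is written without subtractions. Absence of collisions makes the beads
  -- above row `p` strictly larger than the moved one.
  have hex : ∃ j, nu.rowLen j + i < nu.rowLen i + v + j := ⟨i, by omega⟩
  classical
  set p := Nat.find hex with hp
  have hpi : p ≤ i := Nat.find_min' hex (by omega)
  have hspec : nu.rowLen p + i < nu.rowLen i + v + p := Nat.find_spec hex
  have hmin : ∀ j < p, nu.rowLen i + v + j < nu.rowLen j + i := by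
    intro j hj
    have h1 := Nat.find_min hex hj
    have h2 := h j (by omega)
    omega
  let f : ℕ → ℕ := fun j => if j < p ∨ i < j then nu.rowLen j else
    if j = p then nu.rowLen i + v - (i - p) else nu.rowLen (j - 1) + 1
  have hf : Antitone f := by
    refine antitone_nat_of_succ_le fun j => ?_
    have h1 := nu.rowLen_anti j (j + 1) (by omega)
    have h2 := nu.rowLen_anti (j - 1) j (by omega)
    have h3 := hmin j
    simp only [f, Nat.add_sub_cancel]
    rcases lt_trichotomy j p with hj | rfl | hj
    · split_ifs <;> omega
    · rcases hpi.eq_or_lt with hpi | hpi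
      · rw [← hpi] at *
        split_ifs <;> omega
      · split_ifs <;> omega
    · split_ifs <;> omega
  have hK : ∀ j, max (nu.colLen 0) (i + 1) ≤ j → f j = 0 := by
    intro j hj
    have h1 : i < j := by omega
    simp only [f, if_pos (Or.inr h1 : j < p ∨ i < j)]
    exact rowLen_eq_zero (by omega)
  have hrow := rowLen_ofRowLen f hf _ hK
  have hstep : RibbonStep nu (ofRowLen f hf (max (nu.colLen 0) (i + 1))) p i := by
    refine ⟨hpi, fun j hj => ?_, fun j hpj hji => ?_, ?_⟩
    · rw [hrow]
      simp only [f, if_pos hj]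
    · rw [hrow]
      simp only [f, Nat.add_sub_cancel]
      rw [if_neg (by omega), if_neg (by omega)]
    · rw [hrow]
      simp only [f]
      rw [if_neg (by omega), if_pos trivial]
      omega
  refine ⟨_, p, hstep, ?_⟩
  have h1 := hstep.card_add
  have h2 : f p = nu.rowLen i + v - (i - p) := by
    simp only [f]
    rw [if_neg (by omega), if_pos trivial]
  rw [hrow, h2] at h1
  omega

/-- The ribbon step is determined by the size of the ribbon and the row of its tail. -/
theorem RibbonStep.unique {nu lam lam' : YoungDiagram} {p p' i : ℕ} (h : RibbonStep nu lam p i)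
    (h' : RibbonStep nu lam' p' i)
    (hc : (lam.cells \ nu.cells).card = (lam'.cells \ nu.cells).card) : lam = lam' := by
  have key : ∀ {lam lam' : YoungDiagram} {p p' : ℕ}, RibbonStep nu lam p i →
      RibbonStep nu lam' p' i → (lam.cells \ nu.cells).card = (lam'.cells \ nu.cells).card →
      p ≤ p' := by
    intro lam lam' p p' h h' hc
    by_contra hlt
    have h1 := h.card_add
    have h2 := h'.card_add
    have h3 := lam.rowLen_anti (p - 1) p (by omega)
    have h4 := h.rowLen_eq (p - 1) (by omega)
    have h5 := nu.rowLen_anti p' (p - 1) (by omega)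
    have h6 := h'.rowLen_lt
    have := h.le
    omega
  obtain rfl : p = p' := le_antisymm (key h h' hc) (key h' h hc.symm)
  have h1 : ∀ j, lam.rowLen j = lam'.rowLen j := by
    intro j
    by_cases hj : p ≤ j ∧ j ≤ i
    · rcases hj.1.eq_or_lt with rfl | hpj
      · have h1 := h.card_add
        have h2 := h'.card_add
        omega
      · obtain ⟨k, rfl⟩ : ∃ k, j = k + 1 := ⟨j - 1, by omega⟩
        rw [h.rowLen_succ k (by omega) (by omega), h'.rowLen_succ k (by omega) (by omega)]
    · rw [h.rowLen_eq j (by omega), h'.rowLen_eq j (by omega)]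
  exact le_antisymm (le_iff_rowLen_le.2 fun j => (h1 j).le)
    (le_iff_rowLen_le.2 fun j => (h1 j).ge)

/-! ### Frozen sequences and the counting of labelings -/

/-- The sequences of ribbons that can be added one after another to `nu`, with tails in weakly
ascending rows, the first one at most `r` and none of them the first row. -/
def IsFrozenSequence : YoungDiagram → ℕ → List (Finset (ℕ × ℕ)) → Prop
  | _, _, [] => True
  | nu, r, ξ :: l => ∃ lam p i, RibbonStep nu lam p i ∧ ξ = lam.cells \ nu.cells ∧ 0 < i ∧ i ≤ r ∧
      IsFrozenSequence lam i l

/-- The sizes of the ribbons of a sequence. -/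
def sizes (l : List (Finset (ℕ × ℕ))) : Multiset ℕ := (l.map Finset.card : List ℕ)

/-- The product of the signs of the ribbons of a sequence. -/
def signs (l : List (Finset (ℕ × ℕ))) : ℤ := (l.map fun ξ => (-1) ^ height ξ).prod

open Classical in
/-- The Young diagram with the given cells; empty if there is none. -/
def diagramOf (s : Finset (ℕ × ℕ)) : YoungDiagram :=
  if h : IsLowerSet (s : Set (ℕ × ℕ)) then ⟨s, h⟩ else ⊥

theorem diagramOf_cells (nu : YoungDiagram) : diagramOf nu.cells = nu := by
  rw [diagramOf, dif_pos nu.isLowerSet]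

/-- The product of the factorials of the multiplicities of a multiset. -/
def multFact (M : Multiset ℕ) : ℕ := ∏ i ∈ M.toFinset, (M.count i).factorial

theorem multFact_eq_prod (M : Multiset ℕ) {s : Finset ℕ} (h : M.toFinset ⊆ s) :
    multFact M = ∏ i ∈ s, (M.count i).factorial := by
  refine Finset.prod_subset h fun i _ hi => ?_
  rw [Multiset.count_eq_zero_of_notMem (by simpa using hi), Nat.factorial_zero]

theorem multFact_pos (M : Multiset ℕ) : 0 < multFact M :=
  Finset.prod_pos fun _ _ => Nat.factorial_pos _

theorem multFact_erase {M : Multiset ℕ} {v : ℕ} (h : v ∈ M) :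
    multFact M = M.count v * multFact (M.erase v) := by
  have hv : v ∈ M.toFinset := Multiset.mem_toFinset.2 h
  rw [multFact_eq_prod (M.erase v) (Multiset.toFinset_subset.2 (Multiset.erase_subset v M)),
    multFact, ← Finset.mul_prod_erase _ _ hv, ← Finset.mul_prod_erase _ _ hv, ← mul_assoc,
    Multiset.count_erase_self, Nat.mul_factorial_pred (Multiset.count_pos.2 h).ne']
  congr 1
  refine Finset.prod_congr rfl fun i hi => ?_
  rw [Multiset.count_erase_of_ne (Finset.ne_of_mem_erase hi)]

/-- The number of ways to label the parts of `M` once the parts in `K` have been put in a given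
order, followed by the others in any order. -/
def labelings (M K : Multiset ℕ) : ℂ :=
  (multFact M : ℂ) * ((M - K).card.factorial : ℂ) / (multFact (M - K) : ℂ)

theorem labelings_zero (M : Multiset ℕ) : labelings M 0 = M.card.factorial := by
  have : (multFact M : ℂ) ≠ 0 := Nat.cast_ne_zero.2 (multFact_pos M).ne'
  rw [labelings, tsub_zero, mul_div_cancel_left₀ _ this]

/-- A first part of size `v` can be labelled by any of the parts of `M` of that size; the rest is a
labelling problem for `M.erase v`. -/
theorem labelings_cons {M K : Multiset ℕ} {v : ℕ} (h : v ∈ M) :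
    labelings M (v ::ₘ K) = M.count v * labelings (M.erase v) K := by
  rw [labelings, labelings, multFact_erase h, Multiset.sub_cons]
  push_cast
  ring

/-! ### Expansion of `transfer` over frozen sequences -/

section

variable {ι : Type} [Fintype ι] [DecidableEq ι] {N : ℕ}

/-- Strictly between the rows `p` and `i`, and at `p` when `p < i`, the beads keep their values but
move one index down, while the enlarged bead of row `i` jumps to index `p`. Sorting is therefore a
single cycle. -/
theorem shifted_add_single {nu lam : YoungDiagram} {p i : Fin (N + 1)}
    (h : RibbonStep nu lam p i) :
    shifted nu (N + 1) + Pi.single i (lam.cells \ nu.cells).card =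
      shifted lam (N + 1) ∘ Fin.cycleIcc p i := by
  have hle : p ≤ i := h.le
  funext j
  simp only [Pi.add_apply, Function.comp, shifted, staircase, Nat.add_sub_cancel]
  have hi := i.2
  rcases lt_trichotomy j i with hj | rfl | hj
  · rw [Pi.single_eq_of_ne hj.ne]
    rcases lt_or_ge j p with hjp | hjp
    · rw [Fin.cycleIcc_of_lt hjp, h.rowLen_eq j (Or.inl hjp), add_zero]
    · have hj' : j.1 < i.1 := hj
      rw [Fin.cycleIcc_of_ge_of_lt hjp hj, Fin.val_add_one_of_lt' (by omega),
        h.rowLen_succ j hjp hj]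
      omega
  · rw [Pi.single_eq_same, Fin.cycleIcc_of_last hle]
    have := h.card_add
    have hle' : p.1 ≤ j.1 := hle
    omega
  · rw [Pi.single_eq_of_ne hj.ne', Fin.cycleIcc_of_gt hj, h.rowLen_eq j (Or.inr hj), add_zero]

theorem cycleIcc_mem_Iic {p i : Fin (N + 1)} (h : p ≤ i) (x : Fin (N + 1)) :
    Fin.cycleIcc p i x ∈ Finset.Iic i ↔ x ∈ Finset.Iic i := by
  rw [Finset.mem_Iic, Finset.mem_Iic]
  rcases lt_trichotomy x i with hx | rfl | hx
  · refine iff_of_true ?_ hx.le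
    rcases lt_or_ge x p with hxp | hxp
    · rw [Fin.cycleIcc_of_lt hxp]
      exact hx.le
    · have hx' : x.1 < i.1 := hx
      have hi := i.2
      rw [Fin.cycleIcc_of_ge_of_lt hxp hx, Fin.le_def, Fin.val_add_one_of_lt' (by omega)]
      exact hx
  · rw [Fin.cycleIcc_of_last h]
    exact iff_of_true h le_rfl
  · rw [Fin.cycleIcc_of_gt hx]

/-- The sorting cycle on `p, …, i` stays inside `Finset.Iic i`, the set of variables still
available, so antisymmetry applies; its sign is `(-1) ^ (i - p)`, the sign of the ribbon. -/
theorem transfer_ribbonStep (a : ι → ℕ) (S : Finset ι) {nu lam : YoungDiagram} {p : ℕ}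
    {i : Fin (N + 1)} (h : RibbonStep nu lam p i) :
    transfer a (shifted nu (N + 1) + Pi.single i (lam.cells \ nu.cells).card) S (Finset.Iic i) =
      ((-1) ^ height (lam.cells \ nu.cells) : ℤ) •
        transfer a (shifted lam (N + 1)) S (Finset.Iic i) := by
  have hp : p < N + 1 := h.le.trans_lt i.2
  have h' : RibbonStep nu lam (⟨p, hp⟩ : Fin (N + 1)) i := h
  have hle : (⟨p, hp⟩ : Fin (N + 1)) ≤ i := h.le
  rw [shifted_add_single h', transfer_comp_perm a _ S _ _ (cycleIcc_mem_Iic hle),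
    Fin.sign_cycleIcc_of_le hle, h.height_eq]
  simp

/-- The only obstruction to adding the ribbon is a collision with the bead of an earlier row. Both
exponents then belong to available variables, and antisymmetry gives zero. -/
theorem transfer_eq_zero_of_no_step (a : ι → ℕ) (S : Finset ι) (nu : YoungDiagram) {v : ℕ}
    (hv : 0 < v) {i : Fin (N + 1)}
    (h : ¬ ∃ lam p, RibbonStep nu lam p i ∧ (lam.cells \ nu.cells).card = v) :
    transfer a (shifted nu (N + 1) + Pi.single i v) S (Finset.Iic i) = 0 := by
  have h1 := mt (exists_ribbonStep_of_size nu i v hv) h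
  push Not at h1
  obtain ⟨j, hj, hcol⟩ := h1
  have hi := i.2
  have hlt : (⟨j, hj.trans hi⟩ : Fin (N + 1)) < i := hj
  refine transfer_eq_zero a S hlt.ne' (Finset.mem_Iic.2 le_rfl) (Finset.mem_Iic.2 hlt.le) ?_
  simp only [Pi.add_apply, Pi.single_eq_same, Pi.single_eq_of_ne hlt.ne, shifted, staircase,
    Nat.add_sub_cancel]
  omega

theorem rowLen_extendFirstRow (lam : YoungDiagram) (n j : ℕ) :
    (extendFirstRow lam n).rowLen j = lam.rowLen j + if j = 0 then n - lam.card else 0 := by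
  refine eq_of_forall_lt_iff fun c => ?_
  rw [← YoungDiagram.mem_iff_lt_rowLen, ← YoungDiagram.mem_cells]
  simp only [extendFirstRow, Finset.mem_union, Finset.mem_product, Finset.mem_singleton,
    Finset.mem_range, YoungDiagram.mem_cells, YoungDiagram.mem_iff_lt_rowLen]
  by_cases hj : j = 0
  · subst hj
    simp only [if_true, true_and]
    omega
  · simp [hj]

theorem shifted_extendFirstRow (nu : YoungDiagram) {n d : ℕ} (h : nu.card + d = n) :
    shifted (extendFirstRow nu n) (N + 1) = shifted nu (N + 1) + Pi.single 0 d := by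
  funext j
  simp only [Pi.add_apply, shifted, rowLen_extendFirstRow]
  rcases eq_or_ne j 0 with rfl | hj
  · simp only [Fin.val_zero, if_true, Pi.single_eq_same]
    omega
  · have : j.1 ≠ 0 := fun h => hj (Fin.ext h)
    simp [this, hj]

theorem RibbonStep.union_unionCells_cons {nu lam : YoungDiagram} {p i : ℕ}
    (h : RibbonStep nu lam p i) (l : List (Finset (ℕ × ℕ))) :
    nu.cells ∪ unionCells ((lam.cells \ nu.cells) :: l) = lam.cells ∪ unionCells l := by
  conv_rhs => rw [h.cells_eq_union, Finset.union_assoc]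
  rfl

/-- The contribution of a frozen sequence of ribbons added to `nu`. -/
def contribution (N n : ℕ) (M : Multiset ℕ) (nu : YoungDiagram) (l : List (Finset (ℕ × ℕ))) :
    MvPolynomial (Fin (N + 1)) ℂ :=
  (labelings M (sizes l) * (signs l : ℂ)) •
    alternant (shifted (extendFirstRow (diagramOf (nu.cells ∪ unionCells l)) n) (N + 1))

theorem contribution_cons {n : ℕ} {M : Multiset ℕ} {nu lam : YoungDiagram} {p i : ℕ}
    (h : RibbonStep nu lam p i) (hM : (lam.cells \ nu.cells).card ∈ M)
    (l : List (Finset (ℕ × ℕ))) :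
    contribution N n M nu ((lam.cells \ nu.cells) :: l) =
      M.count (lam.cells \ nu.cells).card •
        ((-1) ^ height (lam.cells \ nu.cells) : ℤ) •
          contribution N n (M.erase (lam.cells \ nu.cells).card) lam l := by
  have h2 : sizes ((lam.cells \ nu.cells) :: l) = (lam.cells \ nu.cells).card ::ₘ sizes l := rfl
  have h3 : signs ((lam.cells \ nu.cells) :: l) =
      (-1) ^ height (lam.cells \ nu.cells) * signs l := by
    rw [signs, List.map_cons, List.prod_cons, signs]
  rw [contribution, contribution, h.union_unionCells_cons, h2, h3, labelings_cons hM, ← Nat.cast_smul_eq_nsmul ℂ,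
    ← Int.cast_smul_eq_zsmul ℂ, smul_smul, smul_smul]
  congr 1
  push_cast
  ring

/-- Induction on the number of letters along `transfer_Iic`: the term in which all letters go to
`x_0` is the contribution of the empty sequence, and removing a letter prepends a ribbon. The set
`C` depends on the sizes only, not on the letters that carry them. -/
theorem transfer_eq_sum_contribution (a : ι → ℕ) (n : ℕ) (k : ℕ) :
    ∀ (M : Multiset ℕ), M.card = k → (∀ v ∈ M, 0 < v) → ∀ (nu : YoungDiagram) (r : Fin (N + 1)),
      nu.card + M.sum = n → ∃ C : Finset (List (Finset (ℕ × ℕ))),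
        (∀ l, l ∈ C ↔ IsFrozenSequence nu r l ∧ sizes l ≤ M) ∧
        ∀ S : Finset ι, S.val.map a = M →
          transfer a (shifted nu (N + 1)) S (Finset.Iic r) = ∑ l ∈ C, contribution N n M nu l := by
  classical
  induction k with
  | zero =>
    intro M hM _ nu r hn
    rw [Multiset.card_eq_zero] at hM
    subst hM
    refine ⟨{[]}, fun l => ?_, fun S hS => ?_⟩
    · rw [Finset.mem_singleton]
      constructor
      · rintro rfl
        exact ⟨trivial, le_rfl⟩
      · rintro ⟨-, h⟩
        have h1 := congrArg Multiset.card (Multiset.le_zero.1 h)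
        rw [sizes, Multiset.coe_card, List.length_map] at h1
        exact List.length_eq_zero_iff.1 h1
    · rw [Multiset.map_eq_zero, Finset.val_eq_zero] at hS
      subst hS
      rw [transfer_Iic, Finset.sum_singleton, contribution]
      have h1 : nu.cells ∪ unionCells [] = nu.cells := Finset.union_empty _
      rw [h1, diagramOf_cells, shifted_extendFirstRow nu hn]
      simp [sizes, signs, labelings_zero]
  | succ k ih =>
    intro M hM hpos nu r hn
    -- `D` collects the sequences whose first ribbon has size `v` and tail row `i`. The condition `v
    -- ∈ M` sits inside the existential so that `D` can be chosen as a total function; the factor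
    -- `M.count v` counts the letters of size `v`.
    have hstep : ∀ (i : Fin (N + 1)) (v : ℕ), ∃ D : Finset (List (Finset (ℕ × ℕ))), v ∈ M →
        (∀ l, l ∈ D ↔ ∃ lam p l', RibbonStep nu lam p i ∧ (lam.cells \ nu.cells).card = v ∧
          l = (lam.cells \ nu.cells) :: l' ∧ IsFrozenSequence lam i l' ∧
            sizes l' ≤ M.erase v) ∧
        ∀ S : Finset ι, S.val.map a = M.erase v →
          M.count v • transfer a (shifted nu (N + 1) + Pi.single i v) S (Finset.Iic i) =
            ∑ l ∈ D, contribution N n M nu l := by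
      intro i v
      by_cases hv : v ∈ M
      swap
      · exact ⟨∅, fun h => absurd h hv⟩
      by_cases hex : ∃ lam p, RibbonStep nu lam p i ∧ (lam.cells \ nu.cells).card = v
      · obtain ⟨lam, p, hs, rfl⟩ := hex
        have hsum := Multiset.sum_erase hv
        have hcard := hs.card_eq
        obtain ⟨C, hC, hCsum⟩ := ih (M.erase (lam.cells \ nu.cells).card)
          (by rw [Multiset.card_erase_of_mem hv, hM]; rfl)
          (fun v hv => hpos v (Multiset.mem_of_mem_erase hv)) lam i (by omega)
        refine ⟨C.image (List.cons (lam.cells \ nu.cells)), fun _ => ⟨fun l => ?_, fun S hS => ?_⟩⟩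
        · rw [Finset.mem_image]
          constructor
          · rintro ⟨l', hl', rfl⟩
            exact ⟨lam, p, l', hs, rfl, rfl, (hC l').1 hl'⟩
          · rintro ⟨lam', p', l', hs', hc, rfl, h⟩
            obtain rfl := hs.unique hs' hc.symm
            exact ⟨l', (hC l').2 h, rfl⟩
        · rw [transfer_ribbonStep a S hs, hCsum S hS,
            Finset.sum_image fun _ _ _ _ h => (List.cons.inj h).2, Finset.smul_sum,
            Finset.smul_sum]
          exact Finset.sum_congr rfl fun l _ => (contribution_cons hs hv l).symm
      · refine ⟨∅, fun _ => ⟨fun l => ?_, fun S _ => ?_⟩⟩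
        · refine iff_of_false (Finset.notMem_empty l) ?_
          rintro ⟨lam, p, -, hs, hc, -⟩
          exact hex ⟨lam, p, hs, hc⟩
        · rw [transfer_eq_zero_of_no_step a S nu (hpos v hv) hex, smul_zero, Finset.sum_empty]
    choose D hD using hstep
    refine ⟨insert [] ((Finset.Ioc 0 r ×ˢ M.toFinset).biUnion fun x => D x.1 x.2),
      fun l => ?_, fun S hS => ?_⟩
    · rw [Finset.mem_insert, Finset.mem_biUnion]
      constructor
      · rintro (rfl | ⟨⟨i, v⟩, hx, hl⟩)
        · exact ⟨trivial, Multiset.zero_le _⟩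
        · rw [Finset.mem_product, Finset.mem_Ioc, Multiset.mem_toFinset] at hx
          obtain ⟨lam, p, l', hs, rfl, rfl, h1, h2⟩ := ((hD i v hx.2).1 l).1 hl
          refine ⟨⟨lam, p, i, hs, rfl, hx.1.1, hx.1.2, h1⟩, ?_⟩
          rw [← Multiset.cons_erase hx.2]
          exact Multiset.cons_le_cons _ h2
      · rintro ⟨h1, h2⟩
        cases l with
        | nil => exact Or.inl rfl
        | cons ξ l =>
          obtain ⟨lam, p, i, hs, rfl, hi0, hir, hl⟩ := h1
          have hv : (lam.cells \ nu.cells).card ∈ M :=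
            Multiset.mem_of_le h2 (Multiset.mem_coe.2 List.mem_cons_self)
          have hi : i < N + 1 := hir.trans_lt r.2
          refine Or.inr ⟨(⟨i, hi⟩, (lam.cells \ nu.cells).card), ?_, ?_⟩
          · rw [Finset.mem_product, Finset.mem_Ioc, Multiset.mem_toFinset]
            exact ⟨⟨hi0, hir⟩, hv⟩
          · refine ((hD ⟨i, hi⟩ _ hv).1 _).2 ⟨lam, p, l, hs, rfl, rfl, hl, ?_⟩
            rw [← Multiset.cons_erase hv] at h2
            exact (Multiset.cons_le_cons_iff _).1 h2
    · have hnil : [] ∉ (Finset.Ioc 0 r ×ˢ M.toFinset).biUnion fun x => D x.1 x.2 := by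
        rw [Finset.mem_biUnion]
        rintro ⟨⟨i, v⟩, hx, hl⟩
        rw [Finset.mem_product, Multiset.mem_toFinset] at hx
        obtain ⟨lam, p, l', -, -, h, -⟩ := ((hD i v hx.2).1 _).1 hl
        exact List.cons_ne_nil _ _ h.symm
      rw [Finset.sum_insert hnil, Finset.sum_biUnion, Finset.sum_product, transfer_Iic]
      · congr 1
        · have h1 : nu.cells ∪ unionCells [] = nu.cells := Finset.union_empty _
          have h2 : ∑ s ∈ S, a s = M.sum := by rw [← hS]; rfl
          have h3 : S.card = M.card := by rw [← hS, Multiset.card_map]; rfl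
          rw [contribution, h1, diagramOf_cells, shifted_extendFirstRow nu hn, h2, h3]
          simp only [sizes, signs, List.map_nil, Multiset.coe_nil, labelings_zero, List.prod_nil,
            Int.cast_one, mul_one]
          rw [Nat.cast_smul_eq_nsmul ℂ]
        · refine Finset.sum_congr rfl fun i _ => ?_
          -- Letters of equal size contribute equally. Each is assigned the fraction `1 / M.count v`
          -- of the sum over `D i v`, and these fractions add up to the whole when the letters are
          -- grouped by size.
          have h1 : ∀ s ∈ S, transfer a (shifted nu (N + 1) + Pi.single i (a s)) (S.erase s)
              (Finset.Iic i) =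
                (M.count (a s) : ℂ)⁻¹ • ∑ l ∈ D i (a s), contribution N n M nu l := by
            intro s hs
            have hv : a s ∈ M := by
              rw [← hS]
              exact Multiset.mem_map_of_mem a hs
            have hne : (M.count (a s) : ℂ) ≠ 0 := Nat.cast_ne_zero.2 (Multiset.count_pos.2 hv).ne'
            rw [← (hD i (a s) hv).2 (S.erase s), ← Nat.cast_smul_eq_nsmul ℂ,
              inv_smul_smul₀ hne]
            rw [Finset.erase_val, Multiset.map_erase_of_mem _ _ hs, hS]
          rw [Finset.sum_congr rfl h1]
          change (S.val.map ((fun v => (M.count v : ℂ)⁻¹ • ∑ l ∈ D i v, contribution N n M nu l) ∘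
            a)).sum = _
          rw [← Multiset.map_map, hS, Finset.sum_multiset_map_count]
          refine Finset.sum_congr rfl fun v hv => ?_
          have hne : (M.count v : ℂ) ≠ 0 :=
            Nat.cast_ne_zero.2 (Multiset.count_pos.2 (Multiset.mem_toFinset.1 hv)).ne'
          rw [← Nat.cast_smul_eq_nsmul ℂ, smul_inv_smul₀ hne]
      -- The first ribbon of a sequence determines `i` as its tail row and `v` as its size.
      · rintro ⟨i, v⟩ hx ⟨i', v'⟩ hx' hne
        rw [Finset.mem_coe, Finset.mem_product, Multiset.mem_toFinset] at hx hx'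
        refine Finset.disjoint_left.2 fun l hl hl' => hne ?_
        obtain ⟨lam, p, l1, hs, hc, rfl, -⟩ := ((hD i v hx.2).1 _).1 hl
        obtain ⟨lam', p', l2, hs', hc', h, -⟩ := ((hD i' v' hx'.2).1 _).1 hl'
        have h := (List.cons.inj h).1
        have h1 := hs.tailRow_eq
        rw [h, hs'.tailRow_eq] at h1
        exact Prod.ext (Fin.ext h1.symm) (by rw [← hc, ← hc', h])

end

/-! ### Tilings as sequences of ribbons -/

theorem tail_mem {ξ : Finset (ℕ × ℕ)} (h : ξ.Nonempty) : (tailRow ξ, tailCol ξ) ∈ ξ := by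
  obtain ⟨⟨i, j⟩, hx, hsup⟩ := Finset.exists_mem_eq_sup ξ h Prod.fst
  have hne : {j | (tailRow ξ, j) ∈ ξ}.Nonempty := by
    refine ⟨j, ?_⟩
    rw [Set.mem_ofPred_eq, tailRow, hsup]
    exact hx
  exact Nat.sInf_mem hne

theorem IsRibbon.nonempty {ξ : Finset (ℕ × ℕ)} (h : IsRibbon ξ) : ξ.Nonempty := by
  obtain ⟨⟨x, hx⟩⟩ := h.2.1.nonempty
  exact ⟨x, hx⟩

theorem subset_unionCells {l : List (Finset (ℕ × ℕ))} {ξ : Finset (ℕ × ℕ)} (h : ξ ∈ l) :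
    ξ ⊆ unionCells l := by
  induction l with
  | nil => simp at h
  | cons ζ l ih =>
    change ξ ⊆ ζ ∪ unionCells l
    rcases List.mem_cons.1 h with rfl | h
    · exact Finset.subset_union_left
    · exact (ih h).trans Finset.subset_union_right

theorem disjoint_unionCells {l : List (Finset (ℕ × ℕ))} {ζ : Finset (ℕ × ℕ)}
    (h : ∀ ξ ∈ l, Disjoint ζ ξ) : Disjoint ζ (unionCells l) := by
  induction l with
  | nil => exact Finset.disjoint_empty_right _
  | cons ξ l ih =>
    exact Finset.disjoint_union_right.2
      ⟨h ξ List.mem_cons_self, ih fun ξ' h' => h ξ' (List.mem_cons_of_mem _ h')⟩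

theorem card_unionCells {l : List (Finset (ℕ × ℕ))} (h : l.Pairwise Disjoint) :
    (unionCells l).card = (sizes l).sum := by
  induction l with
  | nil => rfl
  | cons ξ l ih =>
    rw [List.pairwise_cons] at h
    have h1 : (unionCells (ξ :: l)).card = ξ.card + (unionCells l).card :=
      Finset.card_union_of_disjoint (disjoint_unionCells h.1)
    rw [h1, ih h.2]
    exact (Multiset.sum_cons _ _).symm

/-- The conditions on the ribbons of a monotonic tiling, relative to an inner shape. -/
structure IsTilingFrom (nu : YoungDiagram) (l : List (Finset (ℕ × ℕ))) : Prop where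
  isRibbon : ∀ ξ ∈ l, IsRibbon ξ
  disjoint : l.Pairwise Disjoint
  disjoint_inner : ∀ ξ ∈ l, Disjoint nu.cells ξ
  tails_lt : (l.map tailCol).IsChain (· < ·)
  initial : ∀ i ≤ l.length, ∃ lam : YoungDiagram, nu.cells ∪ unionCells (l.take i) = lam.cells

/-- The union with the first ribbon is again a diagram, so this ribbon is a difference of nested
diagrams and `exists_ribbonStep` applies. -/
theorem IsTilingFrom.exists_step {nu : YoungDiagram} {ξ : Finset (ℕ × ℕ)}
    {l : List (Finset (ℕ × ℕ))} (h : IsTilingFrom nu (ξ :: l)) :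
    ∃ lam p i, RibbonStep nu lam p i ∧ ξ = lam.cells \ nu.cells := by
  obtain ⟨lam, hlam⟩ := h.initial 1 (by simp)
  have h1 : nu.cells ∪ unionCells ((ξ :: l).take 1) = nu.cells ∪ ξ := by
    rw [List.take_succ_cons, List.take_zero]
    exact congrArg _ (Finset.union_empty ξ)
  rw [h1] at hlam
  have hle : nu ≤ lam := by
    change nu.cells ⊆ lam.cells
    rw [← hlam]
    exact Finset.subset_union_left
  have hξ : ξ = lam.cells \ nu.cells := by
    rw [← hlam, Finset.union_sdiff_left]
    exact (Finset.sdiff_eq_self_of_disjoint (h.disjoint_inner ξ List.mem_cons_self).symm).symm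
  obtain ⟨p, i, hs⟩ := exists_ribbonStep hle (hξ ▸ h.isRibbon ξ List.mem_cons_self)
  exact ⟨lam, p, i, hs, hξ⟩

theorem IsTilingFrom.tail {nu lam : YoungDiagram} {p i : ℕ} {l : List (Finset (ℕ × ℕ))}
    (hs : RibbonStep nu lam p i) (h : IsTilingFrom nu ((lam.cells \ nu.cells) :: l)) :
    IsTilingFrom lam l where
  isRibbon ξ hξ := h.isRibbon ξ (List.mem_cons_of_mem _ hξ)
  disjoint := (List.pairwise_cons.1 h.disjoint).2
  disjoint_inner ξ hξ := by
    rw [hs.cells_eq_union]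
    exact Finset.disjoint_union_left.2 ⟨h.disjoint_inner ξ (List.mem_cons_of_mem _ hξ),
      (List.pairwise_cons.1 h.disjoint).1 ξ hξ⟩
  tails_lt := (List.isChain_cons.1 h.tails_lt).2
  initial j hj := by
    obtain ⟨ka, hka⟩ := h.initial (j + 1) (by simpa using hj)
    refine ⟨ka, ?_⟩
    rw [← hka, List.take_succ_cons, hs.union_unionCells_cons]

theorem IsTilingFrom.cons {nu lam : YoungDiagram} {p i : ℕ} {l : List (Finset (ℕ × ℕ))}
    (hs : RibbonStep nu lam p i) (h : IsTilingFrom lam l)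
    (htail : ∀ ξ ∈ l.head?, tailRow ξ ≤ i) :
    IsTilingFrom nu ((lam.cells \ nu.cells) :: l) where
  isRibbon ξ hξ := by
    rcases List.mem_cons.1 hξ with rfl | hξ
    · exact hs.isRibbon
    · exact h.isRibbon ξ hξ
  disjoint := List.pairwise_cons.2
    ⟨fun ξ hξ => (h.disjoint_inner ξ hξ).mono_left Finset.sdiff_subset, h.disjoint⟩
  disjoint_inner ξ hξ := by
    rcases List.mem_cons.1 hξ with rfl | hξ
    · exact Finset.disjoint_sdiff
    · exact (h.disjoint_inner ξ hξ).mono_left hs.diagram_le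
  tails_lt := by
    cases l with
    | nil => exact List.isChain_singleton _
    | cons ξ l =>
      refine List.isChain_cons_cons.2 ⟨?_, h.tails_lt⟩
      obtain ⟨ka, q, j, hs', rfl⟩ := h.exists_step
      rw [hs.tailCol_eq, hs'.tailCol_eq, hs.tail_lt_iff, ← hs'.tailRow_eq]
      exact htail _ rfl
  initial j hj := by
    cases j with
    | zero => exact ⟨nu, Finset.union_empty _⟩
    | succ j =>
      obtain ⟨ka, hka⟩ := h.initial j (by simpa using hj)
      refine ⟨ka, ?_⟩
      rw [← hka, List.take_succ_cons, hs.union_unionCells_cons]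

/-- By `RibbonStep.tail_lt_iff`, consecutive tail columns increase exactly when consecutive tail
rows do not go down. The global conditions on a tiling thus become the step-by-step ones of the
recursion. -/
theorem isFrozenSequence_iff (l : List (Finset (ℕ × ℕ))) : ∀ (nu : YoungDiagram) (r : ℕ),
    IsFrozenSequence nu r l ↔
      IsTilingFrom nu l ∧ (∀ ξ ∈ l, tailRow ξ ≠ 0) ∧ ∀ ξ ∈ l.head?, tailRow ξ ≤ r := by
  induction l with
  | nil =>
    intro nu r
    refine iff_of_true trivial ⟨⟨by simp, List.Pairwise.nil, by simp, List.isChain_nil, ?_⟩, by simp,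
      by simp⟩
    intro i _
    exact ⟨nu, by rw [List.take_nil]; exact Finset.union_empty _⟩
  | cons ξ l ih =>
    intro nu r
    constructor
    · rintro ⟨lam, p, i, hs, rfl, h0, hr, hl⟩
      obtain ⟨h1, h2, h3⟩ := (ih lam i).1 hl
      refine ⟨IsTilingFrom.cons hs h1 h3, fun ζ hζ => ?_, fun ζ hζ => ?_⟩
      · rcases List.mem_cons.1 hζ with rfl | hζ
        · rw [hs.tailRow_eq]
          omega
        · exact h2 ζ hζ
      · obtain rfl : _ = ζ := Option.some.inj hζ
        rwa [hs.tailRow_eq]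
    · rintro ⟨h1, h2, h3⟩
      obtain ⟨lam, p, i, hs, rfl⟩ := h1.exists_step
      have h4 := h2 _ List.mem_cons_self
      have h5 := h3 _ rfl
      rw [hs.tailRow_eq] at h4 h5
      refine ⟨lam, p, i, hs, rfl, Nat.pos_of_ne_zero h4, h5, (ih lam i).2
        ⟨IsTilingFrom.tail hs h1, fun ζ hζ => h2 ζ (List.mem_cons_of_mem _ hζ), fun ζ hζ => ?_⟩⟩
      cases l with
      | nil => simp at hζ
      | cons ζ' l =>
        obtain rfl : ζ' = ζ := Option.some.inj hζ
        obtain ⟨ka, q, j, hs', rfl⟩ := (IsTilingFrom.tail hs h1).exists_step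
        have h6 := (List.isChain_cons_cons.1 h1.tails_lt).1
        rw [hs.tailCol_eq, hs'.tailCol_eq, hs.tail_lt_iff] at h6
        rwa [hs'.tailRow_eq]

namespace MonotonicTiling

theorem ribbons_injective : Function.Injective ribbons := by
  intro T T' h
  have h1 : T.shape = T'.shape := by
    rw [YoungDiagram.ext_iff, ← T.union_eq, ← T'.union_eq, h]
  exact MonotonicTiling.ext h1 h

theorem shape_eq (T : MonotonicTiling) :
    diagramOf ((⊥ : YoungDiagram).cells ∪ unionCells T.ribbons) = T.shape := by
  rw [YoungDiagram.cells_bot, Finset.empty_union, T.union_eq, diagramOf_cells]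

theorem isTilingFrom (T : MonotonicTiling) : IsTilingFrom ⊥ T.ribbons where
  isRibbon := T.isRibbon
  disjoint := T.disjoint
  disjoint_inner ξ _ := by simp
  tails_lt := List.isChain_iff_pairwise.2 T.tails_lt
  initial i hi := by simpa using T.initial i hi

theorem exists_of_isTilingFrom {l : List (Finset (ℕ × ℕ))} (h : IsTilingFrom ⊥ l) :
    ∃ T : MonotonicTiling, T.ribbons = l := by
  have hinit : ∀ i ≤ l.length, ∃ lam : YoungDiagram, unionCells (l.take i) = lam.cells := by
    intro i hi
    simpa using h.initial i hi
  obtain ⟨lam, hlam⟩ := hinit l.length le_rfl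
  rw [List.take_length] at hlam
  exact ⟨⟨lam, l, h.isRibbon, h.disjoint, hlam, List.isChain_iff_pairwise.1 h.tails_lt, hinit⟩, rfl⟩

theorem card_shape (T : MonotonicTiling) : T.shape.card = (sizes T.ribbons).sum := by
  rw [← card_unionCells T.disjoint, T.union_eq]

theorem tail_mem_shape (T : MonotonicTiling) {ξ : Finset (ℕ × ℕ)} (h : ξ ∈ T.ribbons) :
    (tailRow ξ, tailCol ξ) ∈ T.shape := by
  rw [← YoungDiagram.mem_cells, ← T.union_eq]
  exact subset_unionCells h (tail_mem (T.isRibbon ξ h).nonempty)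

/-- The tails of a frozen tiling lie in distinct columns of the second row. -/
theorem length_le_rowLen (T : MonotonicTiling) (h : T.IsFrozen) :
    T.ribbons.length ≤ T.shape.rowLen 1 := by
  have h1 : (T.ribbons.map tailCol).Nodup := T.tails_lt.imp fun h => h.ne
  rw [← List.length_map (f := tailCol), ← List.toFinset_card_of_nodup h1,
    ← Finset.card_range (T.shape.rowLen 1)]
  refine Finset.card_le_card fun c hc => ?_
  rw [List.mem_toFinset, List.mem_map] at hc
  obtain ⟨ξ, hξ, rfl⟩ := hc
  rw [Finset.mem_range]
  have h2 := YoungDiagram.mem_iff_lt_rowLen.1 (T.tail_mem_shape hξ)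
  exact h2.trans_le (T.shape.rowLen_anti _ _ (Nat.one_le_iff_ne_zero.2 (h ξ hξ)))

theorem tailRow_lt (T : MonotonicTiling) {ξ : Finset (ℕ × ℕ)} (h : ξ ∈ T.ribbons) :
    tailRow ξ < T.shape.colLen 0 :=
  (YoungDiagram.mem_iff_lt_colLen.1 (T.tail_mem_shape h)).trans_le
    (T.shape.colLen_anti _ _ (Nat.zero_le _))

end MonotonicTiling

theorem colLen_le_card (lam : YoungDiagram) : lam.colLen 0 ≤ lam.card := by
  rw [YoungDiagram.colLen_eq_card]
  exact Finset.card_le_card (Finset.filter_subset _ _)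

theorem rowLen_add_rowLen_le_card (lam : YoungDiagram) :
    lam.rowLen 0 + lam.rowLen 1 ≤ lam.card := by
  rw [YoungDiagram.rowLen_eq_card, YoungDiagram.rowLen_eq_card, ← Finset.card_union_of_disjoint]
  · exact Finset.card_le_card
      (Finset.union_subset (Finset.filter_subset _ _) (Finset.filter_subset _ _))
  · refine Finset.disjoint_left.2 fun x hx hx' => ?_
    have h1 := (Finset.mem_filter.1 hx).2
    have h2 := (Finset.mem_filter.1 hx').2
    omega

/-! ### Frozen tilings of bounded content -/

section

variable {m : ℕ} (μ : m.Partition)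

theorem count_padOnes (hμ : ∀ i ∈ μ.parts, 1 < i) {n : ℕ} (h : m ≤ n) (i : ℕ) :
    (padOnes μ n h).parts.count i = if i = 1 then n - m else μ.parts.count i := by
  rw [padOnes, Multiset.count_add, Multiset.count_replicate]
  by_cases hi : i = 1
  · subst hi
    rw [Multiset.count_eq_zero_of_notMem fun h => (hμ 1 h).ne rfl]
    simp
  · rw [if_neg hi, if_neg (Ne.symm hi), add_zero]

theorem rho_eq_count (T : MonotonicTiling) (i : ℕ) : T.rho i = (sizes T.ribbons).count i :=
  (Multiset.coe_count i _).symm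

theorem mem_frozenTilings (hμ : ∀ i ∈ μ.parts, 1 < i) {n : ℕ} (h : m ≤ n) (T : MonotonicTiling) :
    T ∈ frozenTilings μ n ↔ T.IsFrozen ∧ sizes T.ribbons ≤ (padOnes μ n h).parts := by
  rw [Multiset.le_iff_count]
  simp only [frozenTilings, Set.mem_ofPred_eq, count_padOnes μ hμ h, ← rho_eq_count]
  refine and_congr_right fun _ => ⟨fun ⟨h1, h2⟩ i => ?_, fun h1 => ⟨?_, fun i hi => ?_⟩⟩
  · rcases lt_trichotomy i 1 with hi | rfl | hi
    · obtain rfl : i = 0 := by omega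
      have : T.rho 0 = 0 := by
        rw [rho_eq_count]
        refine Multiset.count_eq_zero_of_notMem fun h0 => ?_
        obtain ⟨ξ, hξ, h0⟩ := List.mem_map.1 (Multiset.mem_coe.1 h0)
        exact (Finset.card_pos.2 (T.isRibbon ξ hξ).nonempty).ne' h0
      rw [this]
      exact Nat.zero_le _
    · rw [if_pos rfl]
      omega
    · rw [if_neg hi.ne']
      exact h2 i hi
  · have := h1 1
    rw [if_pos rfl] at this
    omega
  · have := h1 i
    rwa [if_neg (by omega)] at this

theorem card_padOnes {n : ℕ} (h : m ≤ n) :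
    (padOnes μ n h).parts.card = n - m + μ.parts.card := by
  rw [padOnes, Multiset.card_add, Multiset.card_replicate, add_comm]

theorem card_sizes (l : List (Finset (ℕ × ℕ))) : (sizes l).card = l.length := by
  rw [sizes, Multiset.coe_card, List.length_map]

theorem two_mul_card_le (hμ : ∀ i ∈ μ.parts, 1 < i) : 2 * μ.parts.card ≤ m := by
  have h1 := Multiset.card_nsmul_le_sum hμ
  rw [μ.parts_sum, smul_eq_mul] at h1
  omega

/-- The ribbon sizes form a submultiset of `μ(n)`. The second bound expresses that the unused parts
are at least `1`, so their sum is at least their number. -/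
theorem card_shape_le (hμ : ∀ i ∈ μ.parts, 1 < i) {n : ℕ} (h : m ≤ n) {T : MonotonicTiling}
    (hT : T ∈ frozenTilings μ n) :
    T.shape.card ≤ n ∧ T.shape.card + μ.parts.card ≤ m + T.ribbons.length := by
  obtain ⟨-, hle⟩ := (mem_frozenTilings μ hμ h T).1 hT
  have h1 := congrArg Multiset.sum (tsub_add_cancel_of_le hle)
  have h2 := congrArg Multiset.card (tsub_add_cancel_of_le hle)
  rw [Multiset.sum_add, (padOnes μ n h).parts_sum, ← T.card_shape] at h1
  rw [Multiset.card_add, card_padOnes, card_sizes] at h2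
  have h3 := Multiset.card_nsmul_le_sum (s := (padOnes μ n h).parts - sizes T.ribbons) (a := 1)
    fun i hi => (padOnes μ n h).parts_pos (Multiset.mem_of_le tsub_le_self hi)
  rw [smul_eq_mul, mul_one] at h3
  omega

/-- Take `n = m + ρ_1(T)`, for which all ones are used and every unused part is at least `2`. With
`s` the size of the shape and `k` the number of ribbons, `m + ρ_1 - s ≥ 2 (ρ_1 + ℓ(μ) - k)`, and `s
≥ 2k` because the first two rows both have at least `k` boxes. -/
theorem rho_one_le (hμ : ∀ i ∈ μ.parts, 1 < i) {T : MonotonicTiling} (hT : T.IsFrozen)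
    (hrho : ∀ i > 1, T.rho i ≤ μ.parts.count i) : T.rho 1 + 2 * μ.parts.card ≤ m := by
  have h : m ≤ m + T.rho 1 := Nat.le_add_right _ _
  obtain ⟨-, hle⟩ := (mem_frozenTilings μ hμ h T).1 ⟨hT, le_rfl, hrho⟩
  have h1 := congrArg Multiset.sum (tsub_add_cancel_of_le hle)
  have h2 := congrArg Multiset.card (tsub_add_cancel_of_le hle)
  rw [Multiset.sum_add, (padOnes μ _ h).parts_sum, ← T.card_shape] at h1
  rw [Multiset.card_add, card_padOnes, card_sizes] at h2
  have h3 := Multiset.card_nsmul_le_sum (s := (padOnes μ _ h).parts - sizes T.ribbons) (a := 2) (by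
    intro i hi
    have h4 := (padOnes μ _ h).parts_pos (Multiset.mem_of_le tsub_le_self hi)
    rcases Nat.lt_or_ge 1 i with h5 | h5
    · exact h5
    · obtain rfl : i = 1 := by omega
      have h6 := Multiset.count_pos.2 hi
      rw [Multiset.count_sub, count_padOnes μ hμ h, if_pos rfl, ← rho_eq_count] at h6
      omega)
  rw [smul_eq_mul] at h3
  have h4 := T.length_le_rowLen hT
  have h5 := rowLen_add_rowLen_le_card T.shape
  have h6 := T.shape.rowLen_anti 0 1 (Nat.zero_le 1)
  omega

theorem frozenTilings_eq (hμ : ∀ i ∈ μ.parts, 1 < i) {n : ℕ} (hn : 2 * (m - μ.parts.card) ≤ n) :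
    frozenTilings μ n = {T | T.IsFrozen ∧ ∀ i > 1, T.rho i ≤ μ.parts.count i} := by
  ext T
  simp only [frozenTilings, Set.mem_ofPred_eq]
  constructor
  · rintro ⟨h1, -, h3⟩
    exact ⟨h1, h3⟩
  · rintro ⟨h1, h3⟩
    have := rho_one_le μ hμ h1 h3
    exact ⟨h1, by omega, h3⟩

/-- Multinomial coefficients are integers; this makes the division of natural numbers in
`coefficient` exact. -/
theorem multFact_dvd (K : Multiset ℕ) : multFact K ∣ K.card.factorial := by
  have := Nat.prod_factorial_dvd_factorial_sum K.toFinset fun i => K.count i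
  rwa [Multiset.toFinset_sum_count_eq] at this

theorem labelings_eq (hμ : ∀ i ∈ μ.parts, 1 < i) {n : ℕ} (h : m ≤ n) {T : MonotonicTiling}
    (hT : T ∈ frozenTilings μ n) :
    labelings (padOnes μ n h).parts (sizes T.ribbons) =
      ((n - m).factorial * multFactorial μ : ℕ) * (coefficient μ n T : ℂ) := by
  obtain ⟨-, hle⟩ := (mem_frozenTilings μ hμ h T).1 hT
  have hmem : ∀ i ∈ (padOnes μ n h).parts, i ∈ insert 1 (Finset.Icc 2 m) := by
    intro i hi
    rcases Multiset.mem_add.1 hi with hi | hi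
    · have h1 := hμ i hi
      have h2 := Multiset.single_le_sum (fun _ _ => Nat.zero_le _) i hi
      rw [μ.parts_sum] at h2
      rw [Finset.mem_insert, Finset.mem_Icc]
      omega
    · rw [Multiset.eq_of_mem_replicate hi]
      exact Finset.mem_insert_self _ _
  have hsub : ∀ K ≤ (padOnes μ n h).parts, K.toFinset ⊆ insert 1 (Finset.Icc 2 m) :=
    fun K hK i hi => hmem i (Multiset.mem_of_le hK (Multiset.mem_toFinset.1 hi))
  have h1 : (1 : ℕ) ∉ Finset.Icc 2 m := by simp
  have hμle : μ.parts ≤ (padOnes μ n h).parts := Multiset.le_add_right _ _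
  have hM : multFact (padOnes μ n h).parts = (n - m).factorial * multFactorial μ := by
    have h2 : multFactorial μ = multFact μ.parts := rfl
    rw [h2, multFact_eq_prod _ (hsub _ le_rfl), multFact_eq_prod _ (hsub _ hμle),
      Finset.prod_insert h1, Finset.prod_insert h1, count_padOnes μ hμ h, if_pos rfl,
      Multiset.count_eq_zero_of_notMem fun h => (hμ 1 h).ne rfl, Nat.factorial_zero, one_mul]
    congr 1
    refine Finset.prod_congr rfl fun i hi => ?_
    rw [count_padOnes μ hμ h, if_neg (by rw [Finset.mem_Icc] at hi; omega)]
  have hK : multFact ((padOnes μ n h).parts - sizes T.ribbons) =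
      (n - m - T.rho 1).factorial * ∏ i ∈ Finset.Icc 2 m, (μ.parts.count i - T.rho i).factorial := by
    rw [multFact_eq_prod _ (hsub _ tsub_le_self), Finset.prod_insert h1, Multiset.count_sub,
      count_padOnes μ hμ h, if_pos rfl, rho_eq_count]
    congr 1
    refine Finset.prod_congr rfl fun i hi => ?_
    rw [Multiset.count_sub, count_padOnes μ hμ h,
      if_neg (by rw [Finset.mem_Icc] at hi; omega), rho_eq_count]
  have hcard : ((padOnes μ n h).parts - sizes T.ribbons).card =
      n - m + μ.parts.card - T.ribbons.length := by
    rw [Multiset.card_sub hle, card_padOnes, card_sizes]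
  have hdvd := multFact_dvd ((padOnes μ n h).parts - sizes T.ribbons)
  have hne : (multFact ((padOnes μ n h).parts - sizes T.ribbons) : ℂ) ≠ 0 :=
    Nat.cast_ne_zero.2 (multFact_pos _).ne'
  rw [coefficient, ← hK, ← hcard, Nat.cast_div hdvd hne, labelings, hM, mul_div_assoc]

/-! ### From polynomials in many variables to symmetric functions -/

theorem SymFun.ext_of_large {f g : SymFun} (K : ℕ) (h : ∀ N, K ≤ N → f.1 (N + 1) = g.1 (N + 1)) :
    f = g := by
  have key : ∀ k N, K + 1 ≤ N + k → f.1 N = g.1 N := by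
    intro k
    induction k with
    | zero =>
      intro N hN
      obtain ⟨N, rfl⟩ : ∃ N', N = N' + 1 := ⟨N - 1, by omega⟩
      exact h N (by omega)
    | succ k ih =>
      intro N hN
      rw [← f.2.2.1 N, ← g.2.2.1 N, ih (N + 1) (by omega)]
  exact Subtype.ext (funext fun N => key (K + 1) N (by omega))

theorem alternant_sigma (T : MonotonicTiling) {n N : ℕ} (h : T.shape.card ≤ N) :
    alternant (shifted (sigma T n) (N + 1)) =
      alternant (staircase (N + 1)) * (schur (sigma T n)).1 (N + 1) := by
  refine schurPoly_spec _ _ ?_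
  by_contra hlt
  have h1 := YoungDiagram.mem_iff_lt_rowLen.1
    (YoungDiagram.mem_iff_lt_colLen.2 (not_le.1 hlt))
  rw [sigma, rowLen_extendFirstRow, if_neg (Nat.succ_ne_zero N), add_zero,
    rowLen_eq_zero ((colLen_le_card _).trans (h.trans N.le_succ))] at h1
  exact lt_irrefl _ h1

/-- Start `transfer_eq_sum_contribution` at the empty diagram, where the exponents are the staircase
and all variables are available, then cancel the alternant of the staircase. -/
theorem exists_finset_frozenTilings (hμ : ∀ i ∈ μ.parts, 1 < i) {n N : ℕ} (h : m ≤ n) (hN : n ≤ N) :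
    ∃ F : Finset MonotonicTiling, (∀ T, T ∈ F ↔ T ∈ frozenTilings μ n) ∧
      (pathPowerSum (padOnes μ n h)).1 (N + 1) = ∑ T ∈ F,
        (labelings (padOnes μ n h).parts (sizes T.ribbons) * (T.sign : ℂ)) •
          (schur (sigma T n)).1 (N + 1) := by
  classical
  set M := (padOnes μ n h).parts with hM
  set α := M.sort (· ≥ ·) with hα
  have hαM : (α : Multiset ℕ) = M := Multiset.sort_eq _ _
  obtain ⟨C, hC, hsum⟩ := transfer_eq_sum_contribution (N := N) α.get n M.card M rfl
    (fun v hv => (padOnes μ n h).parts_pos hv) ⊥ (Fin.last N) (by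
      rw [hM, (padOnes μ n h).parts_sum]
      exact zero_add n)
  have hmem : ∀ T : MonotonicTiling, T.ribbons ∈ C ↔ T ∈ frozenTilings μ n := by
    intro T
    rw [hC, isFrozenSequence_iff, mem_frozenTilings μ hμ h]
    constructor
    · rintro ⟨⟨-, h1, -⟩, h2⟩
      exact ⟨h1, h2⟩
    · rintro ⟨h1, h2⟩
      refine ⟨⟨T.isTilingFrom, h1, fun ξ hξ => ?_⟩, h2⟩
      -- The shape has at most `n ≤ N` rows, so the bound `Fin.last N` on the first tail row
      -- excludes no tiling.
      have h3 := T.tailRow_lt (List.mem_of_mem_head? hξ)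
      have h4 := colLen_le_card T.shape
      have h5 := (card_shape_le μ hμ h ((mem_frozenTilings μ hμ h T).2 ⟨h1, h2⟩)).1
      rw [Fin.val_last]
      omega
  have himage : ∀ l ∈ C, ∃ T : MonotonicTiling, T.ribbons = l := fun l hl =>
    MonotonicTiling.exists_of_isTilingFrom ((isFrozenSequence_iff l _ _).1 ((hC l).1 hl).1).1
  refine ⟨C.preimage _ MonotonicTiling.ribbons_injective.injOn, fun T => ?_, ?_⟩
  · rw [Finset.mem_preimage, hmem]
  · refine mul_left_cancel₀ (alternant_staircase_ne_zero (N + 1)) ?_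
    have h1 := alternant_mul_path α (fun d hd => (padOnes μ n h).parts_pos
      (by rw [← hM, ← hαM]; exact hd)) N (staircase (N + 1))
    have h2 := hsum Finset.univ (by
      rw [← hαM]
      rw [Fin.univ_val_map, List.ofFn_get])
    have h3 : shifted ⊥ (N + 1) = staircase (N + 1) := by
      funext j
      rw [shifted, rowLen_eq_zero ((colLen_le_card _).trans (Nat.zero_le _)), zero_add]
    have h4 : Finset.Iic (Fin.last N) = Finset.univ := by
      ext x
      simp [Fin.le_last]
    rw [h3, h4] at h2
    refine (h1.trans h2).trans ?_
    rw [Finset.mul_sum]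
    symm
    refine Finset.sum_bij (fun T _ => T.ribbons) (fun T hT => Finset.mem_preimage.1 hT)
      (fun _ _ _ _ h => MonotonicTiling.ribbons_injective h) (fun l hl => ?_) fun T hT => ?_
    · obtain ⟨T, rfl⟩ := himage l hl
      exact ⟨T, Finset.mem_preimage.2 hl, rfl⟩
    · rw [Finset.mem_preimage, hmem] at hT
      rw [contribution, T.shape_eq, mul_smul_comm]
      change _ = _ • alternant (shifted (sigma T n) (N + 1))
      rw [alternant_sigma T ((card_shape_le μ hμ h hT).1.trans hN)]
      rfl

theorem frozenTilings_finite (hμ : ∀ i ∈ μ.parts, 1 < i) {n : ℕ} (h : m ≤ n) :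
    (frozenTilings μ n).Finite := by
  obtain ⟨F, hF, -⟩ := exists_finset_frozenTilings μ hμ h le_rfl
  exact F.finite_toSet.subset fun T hT => (hF T).2 hT

end

theorem SymFun.coe_sum_smul {Φ : Type*} (F : Finset Φ) (c : Φ → ℂ) (g : Φ → SymFun) (N : ℕ) :
    (∑ T ∈ F, c T • g T).1 N = ∑ T ∈ F, c T • (g T).1 N := by
  rw [AddSubmonoidClass.coe_finsetSum, Finset.sum_apply]
  rfl

end PathPower

end

open PathPower in
theorem mainTheorem4 {m : ℕ} (μ : m.Partition) (hμ : ∀ i ∈ μ.parts, 1 < i) :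
    (∀ (n : ℕ) (h : m ≤ n), (frozenTilings μ n).Finite ∧
      pathPowerSum (padOnes μ n h) =
        (((n - m).factorial * multFactorial μ : ℕ) : ℂ) •
          ∑ᶠ (T : MonotonicTiling) (_ : T ∈ frozenTilings μ n),
            ((T.sign : ℂ) * (coefficient μ n T : ℂ)) • schur (sigma T n)) ∧
    (∃ F : Set MonotonicTiling, F.Finite ∧
      ∀ n : ℕ, 2 * (m - μ.parts.card) ≤ n → frozenTilings μ n = F) ∧
    (∀ n : ℕ, m ≤ n → ∀ T ∈ frozenTilings μ n,
      (n : ℤ) - 2 * ((m : ℤ) - (μ.parts.card : ℤ)) ≤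
        ((sigma T n).rowLen 0 : ℤ) - ((sigma T n).rowLen 1 : ℤ)) := by
  refine ⟨fun n h => ⟨frozenTilings_finite μ hμ h, ?_⟩, ?_, ?_⟩
  · rw [finsum_mem_eq_finite_toFinset_sum _ (frozenTilings_finite μ hμ h), Finset.smul_sum]
    simp only [smul_smul]
    refine SymFun.ext_of_large n fun N hN => ?_
    obtain ⟨F, hF, hsum⟩ := exists_finset_frozenTilings μ hμ h hN
    rw [hsum, SymFun.coe_sum_smul]
    refine Finset.sum_congr ?_ fun T hT => ?_
    · ext T
      rw [hF, Set.Finite.mem_toFinset]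
    · rw [Set.Finite.mem_toFinset] at hT
      rw [labelings_eq μ hμ h hT]
      congr 1
      ring
  -- At the threshold itself finiteness is already known, since parts greater than `1` give `2 ℓ(μ)
  -- ≤ m` and hence `m ≤ 2 (m - ℓ(μ))`.
  · refine ⟨_, frozenTilings_finite μ hμ (n := 2 * (m - μ.parts.card)) ?_, fun n hn => ?_⟩
    · have := two_mul_card_le μ hμ
      omega
    · rw [frozenTilings_eq μ hμ hn, frozenTilings_eq μ hμ le_rfl]
  · intro n h T hT
    have h1 := card_shape_le μ hμ h hT
    have h2 := T.length_le_rowLen hT.1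
    have h3 := rowLen_add_rowLen_le_card T.shape
    have h4 := T.shape.rowLen_anti 0 1 (Nat.zero_le 1)
    have h5 := two_mul_card_le μ hμ
    rw [sigma, rowLen_extendFirstRow, rowLen_extendFirstRow, if_pos rfl, if_neg one_ne_zero]
    -- With `s` the size of the shape, `k` the number of ribbons and `a ≥ b` the first two rows, `2
    -- (m - ℓ(μ)) ≥ 2 (s - k) ≥ 2 (s - b) ≥ s - a + b`; the last step is `s ≥ a + b` together with
    -- `a ≥ b`.
    omega
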